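/- For $s\in\mathbb{C}$ and $x>0$ let $$J_s(x)=\sum_{n=0}^{\infty}\frac{(-1)^n}{\Gamma(n+1)\Gamma(n+1+s)}\left(\frac{x}{2}\right)^{s+2n}$$ be the Bessel function of the first kind, and for $x>0$, $v\in\mathbb{C}$ let $$k^{+}(x,v)=\frac{1}{2\cos(\pi v)}\bigl(J_{2v-1}(x)-J_{1-2v}(x)\bigr),$$ where at the (removable) singularities $\cos(\pi v)=0$ the value is the limit in $v$. Let $k\ge 1$ be an integer, $t\in\mathbb{R}$ and $0<z<1$. Then the (conditionally convergent) improper integral $$I(z)=\int_{0}^{\infty}J_{2k-1}(y)\,k^{+}\bigl(y\sqrt z,\tfrac12+it\bigr)\,dy=\lim_{R\to\infty}\int_0^R J_{2k-1}(y)\,k^{+}\bigl(y\sqrt z,\tfrac12+it\bigr)\,dy$$ converges, and $$I(z)=\frac{2}{\pi}\bigl(Q_0(z)+(-1)^kQ_1(z)\bigr),$$ where $$Q_0(z)=\int_{1}^{1/\sqrt z}\frac{\cos\bigl(2t\log(y+\sqrt{y^2-1})\bigr)}{\sqrt{1-zy^2}\,\sqrt{y^2-1}}\cos\bigl[(2k-1)\arcsin(y\sqrt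 z)\bigr]\,dy,$$ $$Q_1(z)=\int_{1/\sqrt z}^{\infty}\frac{\cos\bigl(2t\log(y+\sqrt{y^2-1})\bigr)}{\sqrt{y^2z-1}\,\sqrt{y^2-1}}\,\frac{dy}{\bigl(y\sqrt z+\sqrt{y^2z-1}\bigr)^{2k-1}},$$ both integrals being absolutely convergent. Moreover, there is an absolute constant $C>0$ such that for all integers $k\ge1$, all $t\in\mathbb{R}$ and all $0<z<1$ $$|I(z)|\le C\left(1+|\log z|+\frac{1}{(2k-1)\sqrt{1-z}}\right).$$ -/

import Mathlib

open MeasureTheory Filter Topology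

noncomputable section

namespace BesselDecomp

/-- The Bessel function of the first kind of complex order `s` at a real argument `x > 0`,
by its power series. Since `Complex.Gamma` is `0` at the poles of the Gamma function and
`a / 0 = 0`, the terms in which `Γ(n + 1 + s)` has a pole vanish, as they should. -/
def besselJ (s : ℂ) (x : ℝ) : ℂ :=
  ∑' n : ℕ, (-1 : ℂ) ^ n / (Complex.Gamma ((n : ℂ) + 1) * Complex.Gamma ((n : ℂ) + 1 + s)) *
    ((x : ℂ) / 2) ^ (s + 2 * (n : ℂ))

/-- The quotient `(J_{2v-1}(x) - J_{1-2v}(x)) / (2 cos (π v))`. -/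
def kPlusQuot (x : ℝ) (v : ℂ) : ℂ :=
  1 / (2 * Complex.cos (Real.pi * v)) * (besselJ (2 * v - 1) x - besselJ (1 - 2 * v) x)

open Classical in
/-- The kernel `k⁺(x, v)`. At the zeros of `cos (π v)`, which are removable singularities of the
quotient in `v`, it takes the limiting value. -/
def kPlus (x : ℝ) (v : ℂ) : ℂ :=
  if Complex.cos (Real.pi * v) = 0 then limUnder (𝓝[≠] v) (kPlusQuot x) else kPlusQuot x v

/-- The integrand `J_{2k-1}(y) k⁺(y √z, 1/2 + it)` of `I(z)`. -/
def integrandI (k : ℕ) (t z y : ℝ) : ℂ :=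
  besselJ (2 * (k : ℂ) - 1) y * kPlus (y * √z) (1 / 2 + t * Complex.I)

/-- The integral of `f` over `(0, ∞)` converges, possibly only conditionally at infinity,
with value `L`. -/
def HasImproperIntegral (f : ℝ → ℂ) (L : ℂ) : Prop :=
  (∀ R : ℝ, 0 < R → IntervalIntegrable f volume 0 R) ∧
    Tendsto (fun R : ℝ => ∫ y in (0 : ℝ)..R, f y) atTop (𝓝 L)

/-- `I(z) = ∫₀^∞ J_{2k-1}(y) k⁺(y √z, 1/2 + it) dy` as an improper integral at infinity
(it does not converge absolutely). -/
def integralI (k : ℕ) (t z : ℝ) : ℂ :=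
  limUnder atTop (fun R : ℝ => ∫ y in (0 : ℝ)..R, integrandI k t z y)

def integrandQ₀ (k : ℕ) (t z y : ℝ) : ℝ :=
  Real.cos (2 * t * Real.log (y + √(y ^ 2 - 1))) / (√(1 - z * y ^ 2) * √(y ^ 2 - 1)) *
    Real.cos ((2 * (k : ℝ) - 1) * Real.arcsin (y * √z))

def Q₀ (k : ℕ) (t z : ℝ) : ℝ :=
  ∫ y in (1 : ℝ)..(1 / √z), integrandQ₀ k t z y

def integrandQ₁ (k : ℕ) (t z y : ℝ) : ℝ :=
  Real.cos (2 * t * Real.log (y + √(y ^ 2 - 1))) / (√(y ^ 2 * z - 1) * √(y ^ 2 - 1)) *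
    (1 / (y * √z + √(y ^ 2 * z - 1)) ^ (2 * k - 1))

def Q₁ (k : ℕ) (t z : ℝ) : ℝ :=
  ∫ y in Set.Ioi (1 / √z), integrandQ₁ k t z y

end BesselDecomp

end

/-!
Schläfli's integral, which follows from Hankel's contour integral for `1 / Γ` by expanding the
Bessel function in its power series, turns the quotient defining `k⁺` into an integral that no
longer has a singularity at the zeros of `cos (π v)`. Shifting the contour then yields the
Mehler–Sonine formula `k⁺(x, 1/2 + it) = (2/π) ∫₀^∞ cos(x cosh ξ) cos(2tξ) dξ`, with an error of
order `1 / (x sinh T)` when the integral is cut off at `T`.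

By Fubini's theorem `I(z)` becomes `2/π` times the integral over `ξ > 0` of `cos(2tξ)` against the
cosine transform of `J_{2k-1}` at `a = √z cosh ξ`. The truncations of this cosine transform are
bounded by a multiple of `|1 - a|^{-1/2}`, as an integration by parts against Bessel's equation
shows; hence the limit may be taken under the integral. By Abel's theorem the limit is a boundary
value of the Laplace transform of `J_{2k-1}`, which is a geometric series: it equals
`cos((2k-1) arcsin a) / √(1 - a²)` for `a < 1` and, up to the sign `(-1)^k`, the function
`1 / (√(a² - 1) (a + √(a² - 1))^{2k-1})` for `a > 1`. Substituting `y = cosh ξ`, the two ranges give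
`Q₀` and `Q₁`.
-/

noncomputable section

namespace BesselDecomp

open scoped Real

section Hankel

open Complex

lemma hasSum_integral_pow_div_factorial_mul {α : Type*} [MeasurableSpace α] {μ : Measure α}
    {u g : α → ℂ} {C : ℝ} (hu : AEStronglyMeasurable u μ) (huC : ∀ᵐ x ∂μ, ‖u x‖ ≤ C)
    (hg : Integrable g μ) :
    HasSum (fun m : ℕ => ∫ x, u x ^ m / m.factorial * g x ∂μ) (∫ x, cexp (u x) * g x ∂μ) := by
  have summable_bound (x : α) : Summable fun m : ℕ => C ^ m / m.factorial * ‖g x‖ :=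
    (Real.summable_pow_div_factorial C).mul_right _
  refine hasSum_integral_of_dominated_convergence (fun m x => C ^ m / m.factorial * ‖g x‖)
    (fun m => by fun_prop) (fun m => ?_) (ae_of_all _ summable_bound) ?_ (ae_of_all _ fun x => ?_)
  · filter_upwards [huC] with x hx
    rw [norm_mul, norm_div, norm_pow, Complex.norm_natCast]
    gcongr
  · simpa only [tsum_mul_right] using hg.norm.const_mul _
  · rw [exp_eq_exp_ℂ]
    exact (NormedSpace.expSeries_div_hasSum_exp (u x)).mul_right _

lemma exp_neg_mul_sinh_mul_exp_le {x : ℝ} (hx : 0 < x) (A : ℝ) {ξ : ℝ} (hξ : 0 ≤ ξ) :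
    Real.exp (-(x * Real.sinh ξ)) * Real.exp (A * ξ) ≤
      Real.exp ((A + 1) ^ 2 / x) * Real.exp (-ξ) := by
  rw [← Real.exp_add, ← Real.exp_add, Real.exp_le_exp]
  have quadratic_le_sinh : ξ ^ 2 / 4 ≤ Real.sinh ξ := by
    have h₁ := Real.quadratic_le_exp_of_nonneg hξ
    have h₂ : Real.exp (-ξ) ≤ 1 := Real.exp_le_one_iff.mpr (neg_nonpos.mpr hξ)
    rw [Real.sinh_eq]
    linarith
  have complete_square : (A + 1) * ξ - x * (ξ ^ 2 / 4) ≤ (A + 1) ^ 2 / x := by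
    rw [le_div_iff₀ hx]
    nlinarith [sq_nonneg (2 * (A + 1) - x * ξ)]
  linarith [mul_le_mul_of_nonneg_left quadratic_le_sinh hx.le]

lemma integrableOn_exp_neg_mul_sinh_mul_exp {x : ℝ} (hx : 0 < x) (A : ℝ) :
    IntegrableOn (fun ξ : ℝ => Real.exp (-(x * Real.sinh ξ)) * Real.exp (A * ξ)) (Set.Ioi 0) := by
  refine ((integrableOn_exp_neg_Ioi 0).const_mul (Real.exp ((A + 1) ^ 2 / x))).mono'
    (by fun_prop : Continuous _).aestronglyMeasurable ?_
  filter_upwards [ae_restrict_mem measurableSet_Ioi] with ξ hξ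
  rw [Real.norm_of_nonneg (by positivity)]
  exact exp_neg_mul_sinh_mul_exp_le hx A (le_of_lt hξ)

lemma norm_cexp_neg_mul_cexp_mul_cexp_le {r : ℝ} (hr : 0 < r) (a : ℂ) (ξ : ℝ) :
    ‖cexp (-(r * cexp ξ)) * cexp (a * ξ)‖ ≤
      Real.exp (-(r * Real.sinh ξ)) * Real.exp (a.re * ξ) := by
  have sinh_le_exp : Real.sinh ξ ≤ Real.exp ξ := by
    linarith [Real.cosh_add_sinh ξ, Real.cosh_pos ξ]
  rw [norm_mul, norm_exp, norm_exp, ← ofReal_exp, ← ofReal_mul, ← ofReal_neg, ofReal_re,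
    re_mul_ofReal]
  gcongr

lemma integrableOn_cexp_neg_mul_cexp_mul_cexp {r : ℝ} (hr : 0 < r) (a : ℂ) :
    IntegrableOn (fun ξ : ℝ => cexp (-(r * cexp ξ)) * cexp (a * ξ)) (Set.Ioi 0) :=
  (integrableOn_exp_neg_mul_sinh_mul_exp hr a.re).mono'
    (by fun_prop : Continuous _).aestronglyMeasurable
    (ae_of_all _ (norm_cexp_neg_mul_cexp_mul_cexp_le hr a))

lemma natCast_add_ne_zero_of_re_pos {a : ℂ} (ha : 0 < a.re) (m : ℕ) : (m + a : ℂ) ≠ 0 := by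
  refine ne_of_apply_ne re ?_
  rw [add_re, natCast_re, zero_re]
  positivity

lemma integral_cexp_I_mul {c : ℂ} (hc : c ≠ 0) :
    ∫ θ in (-π)..π, cexp (I * c * θ) = 2 * sin (π * c) / c := by
  rw [integral_exp_mul_complex (mul_ne_zero I_ne_zero hc), Complex.sin]
  push_cast
  rw [show I * c * (π : ℂ) = π * c * I by ring, show I * c * (-π : ℂ) = -(π * c) * I by ring]
  field_simp
  linear_combination (cexp (π * c * I) - cexp (-(π * c * I))) * I_sq

lemma inv_Gamma_one_sub {a : ℂ} (ha : 0 < a.re) :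
    (Gamma (1 - a))⁻¹ = Gamma a * sin (π * a) / π := by
  have reflection := inv_inj.mpr (Gamma_mul_Gamma_one_sub a)
  rw [mul_inv, inv_div] at reflection
  rw [mul_div_assoc, ← reflection, mul_inv_cancel_left₀ (Gamma_ne_zero_of_re_pos ha)]

/-- The part of Hankel's contour integral for `1 / Γ` over the circle of radius `r`, for the
exponent `-a` and up to the factor `2 π r ^ (-a)`. -/
def hankelCircle (r : ℝ) (a : ℂ) : ℂ :=
  ∫ θ in (-π)..π, cexp (r * cexp (I * θ)) * cexp (I * a * θ)

/-- The part of Hankel's contour integral for `1 / Γ` over one edge of the cut `(-∞, -r)`, which is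
parametrized by `-r e ^ ξ`. -/
def hankelRay (r : ℝ) (a : ℂ) : ℂ :=
  ∫ ξ in Set.Ioi (0 : ℝ), cexp (-(r * cexp ξ)) * cexp (a * ξ)

lemma hasSum_hankelCircle (r : ℝ) (a : ℂ) :
    HasSum (fun m : ℕ => (r : ℂ) ^ m / m.factorial * ∫ θ in (-π)..π, cexp (I * (m + a) * θ))
      (hankelCircle r a) := by
  have norm_circle (θ : ℝ) : ‖(r : ℂ) * cexp (I * θ)‖ ≤ |r| := by simp [norm_exp_I_mul_ofReal]
  simp only [hankelCircle, intervalIntegral.integral_of_le (neg_le_self Real.pi_nonneg),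
    ← integral_const_mul]
  refine (hasSum_integral_pow_div_factorial_mul (by fun_prop : Continuous _).aestronglyMeasurable
    (ae_of_all _ norm_circle)
    (by fun_prop : Continuous fun θ : ℝ => cexp (I * a * θ)).integrableOn_Ioc).congr_fun
      fun m => integral_congr_ae (ae_of_all _ fun θ => ?_)
  simp only [mul_pow, ← exp_nat_mul, mul_add, add_mul, exp_add]
  ring_nf

lemma hasSum_integral_Iic_cexp_neg_mul_cexp (r : ℝ) {a : ℂ} (ha : 0 < a.re) :
    HasSum (fun m : ℕ => (-r : ℂ) ^ m / m.factorial * (1 / (m + a)))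
      (∫ ξ in Set.Iic (0 : ℝ), cexp (-(r * cexp ξ)) * cexp (a * ξ)) := by
  have norm_le : ∀ᵐ ξ : ℝ ∂volume.restrict (Set.Iic 0), ‖-((r : ℂ) * cexp ξ)‖ ≤ |r| := by
    filter_upwards [ae_restrict_mem measurableSet_Iic] with ξ hξ
    rw [norm_neg, norm_mul, norm_exp, ofReal_re, norm_real, Real.norm_eq_abs]
    exact mul_le_of_le_one_right (abs_nonneg r) (Real.exp_le_one_iff.mpr hξ)
  refine (hasSum_integral_pow_div_factorial_mul (by fun_prop : Continuous _).aestronglyMeasurable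
    norm_le (integrableOn_exp_mul_complex_Iic ha 0)).congr_fun fun m => ?_
  have re_pos : 0 < (m + a).re := by
    rw [add_re, natCast_re]
    positivity
  have integral_exp := integral_exp_mul_complex_Iic re_pos 0
  rw [ofReal_zero, mul_zero, Complex.exp_zero] at integral_exp
  rw [← integral_exp, ← integral_const_mul]
  congr 1 with ξ
  rw [neg_mul_eq_neg_mul, mul_pow, ← exp_nat_mul, add_mul, exp_add]
  ring

lemma integrable_and_integral_cexp_neg_mul_cexp {r : ℝ} (hr : 0 < r) {a : ℂ} (ha : 0 < a.re) :
    Integrable (fun ξ : ℝ => cexp (-(r * cexp ξ)) * cexp (a * ξ)) ∧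
      ∫ ξ : ℝ, cexp (-(r * cexp ξ)) * cexp (a * ξ) = (r : ℂ) ^ (-a) * Gamma a := by
  have one_div_cpow : (1 / (r : ℂ)) ^ a = (r : ℂ) ^ (-a) := by
    rw [one_div, inv_cpow _ _ (by rw [arg_ofReal_of_nonneg hr.le]; exact Real.pi_pos.ne), cpow_neg]
  have integral_eq : ∫ ξ : ℝ, cexp (-(r * cexp ξ)) * cexp (a * ξ) = (r : ℂ) ^ (-a) * Gamma a := by
    rw [← one_div_cpow, ← integral_cpow_mul_exp_neg_mul_Ioi ha hr, ← Real.range_exp,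
      ← Set.image_univ, integral_image_eq_integral_abs_deriv_smul MeasurableSet.univ
      (fun ξ _ => (Real.hasDerivAt_exp ξ).hasDerivWithinAt) Real.exp_injective.injOn,
      setIntegral_univ]
    refine integral_congr_ae (ae_of_all _ fun ξ => ?_)
    simp only [abs_of_pos (Real.exp_pos ξ), real_smul]
    rw [cpow_def_of_ne_zero (ofReal_ne_zero.mpr (Real.exp_ne_zero ξ)),
      ← ofReal_log (Real.exp_pos ξ).le, Real.log_exp, ofReal_exp]
    simp only [← Complex.exp_add]
    ring_nf
  refine ⟨?_, integral_eq⟩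
  by_contra not_integrable
  rw [integral_undef not_integrable] at integral_eq
  have cpow_ne_zero : (r : ℂ) ^ (-a) ≠ 0 := by simp [cpow_eq_zero_iff, hr.ne']
  exact mul_ne_zero cpow_ne_zero (Gamma_ne_zero_of_re_pos ha) integral_eq.symm

lemma hankelCircle_eq_of_re_pos (r : ℝ) {a : ℂ} (ha : 0 < a.re) :
    hankelCircle r a =
      2 * sin (π * a) * ∫ ξ in Set.Iic (0 : ℝ), cexp (-(r * cexp ξ)) * cexp (a * ξ) := by
  refine (hasSum_hankelCircle r a).unique
    (((hasSum_integral_Iic_cexp_neg_mul_cexp r ha).mul_left _).congr_fun fun m => ?_)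
  have sin_add_nat : sin (π * (m + a)) = (-1) ^ m * sin (π * a) := by
    rw [show (π * (m + a) : ℂ) = π * a + m * π by ring, sin_antiperiodic.add_nat_mul_eq]
  rw [integral_cexp_I_mul (natCast_add_ne_zero_of_re_pos ha m), sin_add_nat, neg_pow (r : ℂ)]
  ring

lemma hankelCircle_zero (r : ℝ) : hankelCircle r 0 = 2 * π := by
  refine (hasSum_hankelCircle r 0).unique ?_
  convert hasSum_single (0 : ℕ) fun m hm => ?_ using 1
  · simp [two_mul]
  · rw [add_zero, integral_cexp_I_mul (Nat.cast_ne_zero.mpr hm), mul_comm (π : ℂ), sin_nat_mul_pi]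
    simp

lemma mul_hankelCircle_add_one (r : ℝ) (a : ℂ) :
    r * hankelCircle r (a + 1) + a * hankelCircle r a = 2 * cexp (-r) * sin (π * a) := by
  have hasDerivAt_integrand (θ : ℝ) : HasDerivAt
      (fun θ : ℝ => cexp (r * cexp (I * θ)) * cexp (I * a * θ))
      (I * (r * (cexp (r * cexp (I * θ)) * cexp (I * (a + 1) * θ)) +
        a * (cexp (r * cexp (I * θ)) * cexp (I * a * θ)))) θ := by
    have hθ : HasDerivAt (fun θ : ℝ => (θ : ℂ)) 1 θ := ofRealCLM.hasDerivAt
    refine (((hθ.const_mul I).cexp.const_mul (r : ℂ)).cexp.mul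
      (hθ.const_mul (I * a)).cexp).congr_deriv ?_
    rw [show I * (a + 1) * (θ : ℂ) = I * θ + I * a * θ by ring, Complex.exp_add]
    ring
  have ftc := intervalIntegral.integral_eq_sub_of_hasDerivAt (a := -π) (b := π)
    (fun θ _ => hasDerivAt_integrand θ) ((by fun_prop : Continuous _).intervalIntegrable _ _)
  rw [intervalIntegral.integral_const_mul, intervalIntegral.integral_add
    ((by fun_prop : Continuous _).intervalIntegrable _ _)
    ((by fun_prop : Continuous _).intervalIntegrable _ _)] at ftc
  have exp_I_mul_neg_pi : cexp (I * (-π : ℝ)) = -1 := by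
    rw [ofReal_neg, mul_neg, Complex.exp_neg, mul_comm, exp_pi_mul_I, inv_neg_one]
  rw [intervalIntegral.integral_const_mul, intervalIntegral.integral_const_mul, exp_I_mul_neg_pi,
    mul_comm I (π : ℂ), exp_pi_mul_I, mul_neg_one] at ftc
  refine mul_left_cancel₀ I_ne_zero (ftc.trans ?_)
  rw [Complex.sin, show I * a * (π : ℂ) = π * a * I by ring,
    show I * a * ((-π : ℝ) : ℂ) = -(π * a) * I by push_cast; ring]
  linear_combination cexp (-r) * (cexp (π * a * I) - cexp (-(π * a) * I)) * I_sq

lemma mul_hankelRay_add_one {r : ℝ} (hr : 0 < r) (a : ℂ) :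
    r * hankelRay r (a + 1) - a * hankelRay r a = cexp (-r) := by
  have hasDerivAt_integrand (ξ : ℝ) : HasDerivAt (fun ξ : ℝ => cexp (-(r * cexp ξ)) * cexp (a * ξ))
      (a * (cexp (-(r * cexp ξ)) * cexp (a * ξ)) -
        r * (cexp (-(r * cexp ξ)) * cexp ((a + 1) * ξ))) ξ := by
    have hξ : HasDerivAt (fun ξ : ℝ => (ξ : ℂ)) 1 ξ := ofRealCLM.hasDerivAt
    refine ((hξ.cexp.const_mul (r : ℂ)).neg.cexp.mul (hξ.const_mul a).cexp).congr_deriv ?_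
    rw [show (a + 1) * (ξ : ℂ) = ξ + a * ξ by ring, Complex.exp_add, Pi.neg_apply]
    ring
  have tendsto_zero : Tendsto (fun ξ : ℝ => cexp (-(r * cexp ξ)) * cexp (a * ξ)) atTop (𝓝 0) := by
    refine squeeze_zero_norm' ?_ (show Tendsto (fun ξ : ℝ =>
      Real.exp ((a.re + 1) ^ 2 / r) * Real.exp (-ξ)) atTop (𝓝 0) by
        simpa using Real.tendsto_exp_neg_atTop_nhds_zero.const_mul _)
    filter_upwards [eventually_ge_atTop 0] with ξ hξ
    exact (norm_cexp_neg_mul_cexp_mul_cexp_le hr a ξ).trans (exp_neg_mul_sinh_mul_exp_le hr _ hξ)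
  have integrable_a := (integrableOn_cexp_neg_mul_cexp_mul_cexp hr a).const_mul a
  have integrable_r := (integrableOn_cexp_neg_mul_cexp_mul_cexp hr (a + 1)).const_mul (r : ℂ)
  have ftc := integral_Ioi_of_hasDerivAt_of_tendsto
    (hasDerivAt_integrand 0).continuousAt.continuousWithinAt
    (fun ξ _ => hasDerivAt_integrand ξ) (integrable_a.sub integrable_r) tendsto_zero
  rw [integral_sub integrable_a integrable_r, integral_const_mul, integral_const_mul] at ftc
  simp only [ofReal_zero, Complex.exp_zero, mul_zero, mul_one, zero_sub] at ftc
  rw [hankelRay, hankelRay]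
  linear_combination -ftc

/-- Hankel's contour integral for `r ^ (-a) / Γ (1 - a)`, with its circular and its radial part
written out. -/
def hankel (r : ℝ) (a : ℂ) : ℂ :=
  1 / (2 * π) * hankelCircle r a + sin (π * a) / π * hankelRay r a

lemma hankel_eq_of_re_pos {r : ℝ} (hr : 0 < r) {a : ℂ} (ha : 0 < a.re) :
    hankel r a = (r : ℂ) ^ (-a) * (Gamma (1 - a))⁻¹ := by
  obtain ⟨integrable, integral_eq⟩ := integrable_and_integral_cexp_neg_mul_cexp hr ha
  rw [← intervalIntegral.integral_Iic_add_Ioi (b := 0) integrable.integrableOn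
    integrable.integrableOn] at integral_eq
  have hπ : (π : ℂ) ≠ 0 := ofReal_ne_zero.mpr Real.pi_ne_zero
  rw [hankel, hankelCircle_eq_of_re_pos r ha, hankelRay, eq_sub_of_add_eq' integral_eq,
    inv_Gamma_one_sub ha]
  field_simp
  ring

lemma mul_hankel_add_one {r : ℝ} (hr : 0 < r) (a : ℂ) :
    r * hankel r (a + 1) = -a * hankel r a := by
  have hπ : (π : ℂ) ≠ 0 := ofReal_ne_zero.mpr Real.pi_ne_zero
  have sin_add_one : sin (π * (a + 1)) = -sin (π * a) := by rw [mul_add, mul_one, sin_add_pi]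
  rw [hankel, hankel, sin_add_one]
  field_simp
  linear_combination mul_hankelCircle_add_one r a - 2 * sin (π * a) * mul_hankelRay_add_one hr a

lemma hankel_zero (r : ℝ) : hankel r 0 = 1 := by
  have hπ : (π : ℂ) ≠ 0 := ofReal_ne_zero.mpr Real.pi_ne_zero
  rw [hankel, hankelCircle_zero, mul_zero, sin_zero, zero_div, zero_mul, add_zero]
  field_simp

theorem hankel_eq {r : ℝ} (hr : 0 < r) (a : ℂ) :
    hankel r a = (r : ℂ) ^ (-a) * (Gamma (1 - a))⁻¹ := by
  -- The recursion `mul_hankel_add_one` moves the formula one unit to the left in `re a`.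
  suffices ∀ (N : ℕ) (a : ℂ), 0 < a.re + N → hankel r a = (r : ℂ) ^ (-a) * (Gamma (1 - a))⁻¹ by
    obtain ⟨N, hN⟩ := exists_nat_gt (-a.re)
    exact this N a (by linarith)
  intro N
  induction N with
  | zero => exact fun a ha => hankel_eq_of_re_pos hr (by simpa using ha)
  | succ N ih =>
    intro a ha
    rcases eq_or_ne a 0 with rfl | ha0
    · simp [hankel_zero]
    have ih' := ih (a + 1) (by rw [add_re, one_re]; push_cast at ha; linarith)
    have gamma_step := one_div_Gamma_eq_self_mul_one_div_Gamma_add_one (-a)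
    rw [show 1 - (a + 1) = -a by ring, gamma_step, show -(a + 1) = -a - 1 by ring,
      cpow_sub _ _ (ofReal_ne_zero.mpr hr.ne'), cpow_one, show -a + 1 = 1 - a by ring] at ih'
    refine mul_left_cancel₀ (neg_ne_zero.mpr ha0) ?_
    rw [← mul_hankel_add_one hr a, ih']
    field_simp [ofReal_ne_zero.mpr hr.ne']

end Hankel

section Schlafli

open Complex

lemma hasSum_hankelCircle_neg (r : ℝ) (ν : ℂ) :
    HasSum (fun n : ℕ => (-r : ℂ) ^ n / n.factorial * hankelCircle r (-(n + ν)))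
      (∫ θ in (-π)..π, cexp (I * ((2 * r : ℝ) * sin θ - ν * θ))) := by
  have norm_circle (θ : ℝ) : ‖-(r : ℂ) * cexp (-(I * θ))‖ ≤ |r| := by
    rw [show -(I * (θ : ℂ)) = I * (-θ : ℝ) by push_cast; ring]
    simp [norm_exp_I_mul_ofReal, -ofReal_neg]
  have integrand_eq (θ : ℝ) : cexp (I * ((2 * r : ℝ) * sin θ - ν * θ)) =
      cexp (-r * cexp (-(I * θ))) * (cexp (r * cexp (I * θ)) * cexp (-(I * ν * θ))) := by
    rw [← Complex.exp_add, ← Complex.exp_add, Complex.sin,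
      show -(θ : ℂ) * I = -(I * θ) by ring, mul_comm (θ : ℂ) I]
    congr 1
    push_cast
    linear_combination -r * (cexp (I * θ) - cexp (-(I * θ))) * I_sq
  simp only [hankelCircle, integrand_eq, ← integral_const_mul,
    intervalIntegral.integral_of_le (neg_le_self Real.pi_nonneg)]
  refine (hasSum_integral_pow_div_factorial_mul (by fun_prop : Continuous _).aestronglyMeasurable
    (ae_of_all _ norm_circle)
    (by fun_prop : Continuous fun θ : ℝ =>
      cexp (r * cexp (I * θ)) * cexp (-(I * ν * θ))).integrableOn_Ioc).congr_fun
      fun n => integral_congr_ae (ae_of_all _ fun θ => ?_)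
  simp only [mul_pow, ← exp_nat_mul,
    show I * (-(n + ν)) * θ = n * (-(I * θ)) + -(I * ν * θ) by ring, Complex.exp_add]
  ring

lemma hasSum_hankelRay_neg {r : ℝ} (hr : 0 < r) (ν : ℂ) :
    HasSum (fun n : ℕ => (r : ℂ) ^ n / n.factorial * hankelRay r (-(n + ν)))
      (∫ ξ in Set.Ioi (0 : ℝ), cexp (-((2 * r : ℝ) * sinh ξ)) * cexp (-ν * ξ)) := by
  have norm_le : ∀ᵐ ξ : ℝ ∂volume.restrict (Set.Ioi 0), ‖(r : ℂ) * cexp (-ξ)‖ ≤ r := by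
    filter_upwards [ae_restrict_mem measurableSet_Ioi] with ξ hξ
    rw [norm_mul, norm_exp, ← ofReal_neg, ofReal_re, norm_real, Real.norm_of_nonneg hr.le]
    exact mul_le_of_le_one_right hr.le (Real.exp_le_one_iff.mpr (neg_nonpos.mpr (le_of_lt hξ)))
  have integrand_eq (ξ : ℝ) : cexp (-((2 * r : ℝ) * sinh ξ)) * cexp (-ν * ξ) =
      cexp (r * cexp (-ξ)) * (cexp (-(r * cexp ξ)) * cexp (-ν * ξ)) := by
    simp only [← Complex.exp_add, Complex.sinh]
    congr 1
    push_cast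
    ring
  simp only [hankelRay, integrand_eq, ← integral_const_mul]
  refine (hasSum_integral_pow_div_factorial_mul (by fun_prop : Continuous _).aestronglyMeasurable
    norm_le (integrableOn_cexp_neg_mul_cexp_mul_cexp hr (-ν))).congr_fun
      fun n => integral_congr_ae (ae_of_all _ fun ξ => ?_)
  simp only [mul_pow, ← exp_nat_mul, show -(n + ν) * (ξ : ℂ) = n * -ξ + -ν * ξ by ring,
    Complex.exp_add]
  ring

/-- **Schläfli's integral**. -/
theorem besselJ_eq_integral {x : ℝ} (hx : 0 < x) (ν : ℂ) :
    besselJ ν x = 1 / (2 * π) * (∫ θ in (-π)..π, cexp (I * (x * sin θ - ν * θ))) -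
      sin (π * ν) / π * ∫ ξ in Set.Ioi (0 : ℝ), cexp (-(x * sinh ξ)) * cexp (-ν * ξ) := by
  obtain ⟨r, rfl⟩ : ∃ r, x = 2 * r := ⟨x / 2, by ring⟩
  have hr : 0 < r := by linarith
  refine ((((hasSum_hankelCircle_neg r ν).mul_left (1 / (2 * π : ℂ))).sub
    ((hasSum_hankelRay_neg hr ν).mul_left (sin (π * ν) / π))).congr_fun fun n => ?_).tsum_eq
  have sin_neg_add : sin (π * (-(n + ν))) = -((-1) ^ n * sin (π * ν)) := by
    rw [show (π * (-(n + ν)) : ℂ) = -(π * ν + n * π) by ring, Complex.sin_neg,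
      sin_antiperiodic.add_nat_mul_eq]
  have hankel_neg := hankel_eq hr (-(n + ν))
  rw [hankel, sin_neg_add, neg_neg, show 1 - -((n : ℂ) + ν) = n + 1 + ν by ring] at hankel_neg
  have cpow_eq : (((2 * r : ℝ) : ℂ) / 2) ^ (ν + 2 * n) = (r : ℂ) ^ n * (r : ℂ) ^ (n + ν) := by
    rw [show ((2 * r : ℝ) : ℂ) / 2 = r by push_cast; ring,
      show ν + 2 * n = (n : ℂ) + (n + ν) by ring, cpow_add _ _ (ofReal_ne_zero.mpr hr.ne'),
      cpow_natCast]
  have neg_one_pow_sq : (-1 : ℂ) ^ n * (-1) ^ n = 1 := by rw [← mul_pow]; simp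
  rw [cpow_eq, Gamma_nat_eq_factorial, div_eq_mul_inv, mul_inv, neg_pow (r : ℂ) n]
  linear_combination (-1) ^ n * (r : ℂ) ^ n / n.factorial * -hankel_neg -
    (r : ℂ) ^ n / n.factorial * (sin (π * ν) / π) * hankelRay r (-(n + ν)) * neg_one_pow_sq

lemma integral_eq_integral_sub_add {E : Type*} [NormedAddCommGroup E] [NormedSpace ℝ E]
    {f : ℝ → E} (hf : Continuous f) (c h : ℝ) :
    ∫ θ in (c - h)..(c + h), f θ = ∫ φ in (0 : ℝ)..h, (f (c - φ) + f (c + φ)) := by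
  rw [intervalIntegral.integral_add
    ((by fun_prop : Continuous fun φ => f (c - φ)).intervalIntegrable _ _)
    ((by fun_prop : Continuous fun φ => f (c + φ)).intervalIntegrable _ _),
    intervalIntegral.integral_comp_sub_left, intervalIntegral.integral_comp_add_left,
    sub_zero, add_zero, intervalIntegral.integral_add_adjacent_intervals
      (hf.intervalIntegrable _ _) (hf.intervalIntegrable _ _)]

lemma integral_cexp_sin_sub (x w : ℂ) :
    (∫ θ in (-π)..π, cexp (I * (x * sin θ - w * θ))) -
        (∫ θ in (-π)..π, cexp (I * (x * sin θ - -w * θ))) =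
      4 * ∫ θ in (0 : ℝ)..π, sin (w * θ) * sin (x * sin θ) := by
  have symmetrized (φ : ℝ) : cexp (I * (x * sin (0 - φ : ℝ) - w * (0 - φ : ℝ))) -
        cexp (I * (x * sin (0 - φ : ℝ) - -w * (0 - φ : ℝ))) +
      (cexp (I * (x * sin (0 + φ : ℝ) - w * (0 + φ : ℝ))) -
        cexp (I * (x * sin (0 + φ : ℝ) - -w * (0 + φ : ℝ)))) =
      4 * (sin (w * φ) * sin (x * sin φ)) := by
    simp only [zero_sub, zero_add, ofReal_neg, Complex.sin_neg]
    generalize sin (φ : ℂ) = s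
    rw [Complex.sin, Complex.sin,
      show I * (x * -s - w * -φ) = w * φ * I + -(x * s) * I by ring,
      show I * (x * -s - -w * -φ) = -(w * φ) * I + -(x * s) * I by ring,
      show I * (x * s - w * φ) = -(w * φ) * I + x * s * I by ring,
      show I * (x * s - -w * φ) = w * φ * I + x * s * I by ring]
    simp only [Complex.exp_add]
    linear_combination -(cexp (-(w * φ) * I) - cexp (w * φ * I)) *
      (cexp (-(x * s) * I) - cexp (x * s * I)) * I_sq
  rw [← intervalIntegral.integral_sub ((by fun_prop : Continuous _).intervalIntegrable _ _)
    ((by fun_prop : Continuous _).intervalIntegrable _ _),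
    ← intervalIntegral.integral_const_mul]
  have fold := integral_eq_integral_sub_add (f := fun θ : ℝ =>
    cexp (I * (x * sin θ - w * θ)) - cexp (I * (x * sin θ - -w * θ))) (by fun_prop) 0 π
  rw [zero_sub, zero_add] at fold
  simpa only [symmetrized] using fold

lemma integral_sin_mul_sin_mul_sin (x w : ℂ) :
    ∫ θ in (0 : ℝ)..π, sin (w * θ) * sin (x * sin θ) =
      2 * sin (π * w / 2) * ∫ φ in (0 : ℝ)..(π / 2), cos (w * φ) * sin (x * cos φ) := by
  have symmetrized (φ : ℝ) :
      sin (w * (π / 2 - φ : ℝ)) * sin (x * sin (π / 2 - φ : ℝ)) +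
        sin (w * (π / 2 + φ : ℝ)) * sin (x * sin (π / 2 + φ : ℝ)) =
      2 * sin (π * w / 2) * (cos (w * φ) * sin (x * cos φ)) := by
    push_cast
    rw [sin_pi_div_two_sub, add_comm (π / 2 : ℂ) φ, sin_add_pi_div_two, mul_sub, mul_add,
      Complex.sin_sub, Complex.sin_add, show w * (π / 2 : ℂ) = π * w / 2 by ring]
    ring
  have fold := integral_eq_integral_sub_add
    (f := fun θ : ℝ => sin (w * θ) * sin (x * sin θ)) (by fun_prop) (π / 2) (π / 2)
  rw [sub_self, add_halves] at fold
  rw [fold, ← intervalIntegral.integral_const_mul]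
  simp only [symmetrized]

/-- An integral formula for `k⁺(x, v)` in terms of the order `w = 2 v - 1`: unlike the quotient
`kPlusQuot`, it is continuous in `w` everywhere, also at the zeros of `cos (π v)`. -/
def kPlusIntegral (x : ℝ) (w : ℂ) : ℂ :=
  2 / π * (cos (π * w / 2) *
      (∫ ξ in Set.Ioi (0 : ℝ), cexp (-(x * sinh ξ)) * cosh (w * ξ)) -
    ∫ φ in (0 : ℝ)..(π / 2), cos (w * φ) * sin (x * cos φ))

lemma norm_cosh_le_exp_abs_re (z : ℂ) : ‖cosh z‖ ≤ Real.exp |z.re| := by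
  have h₁ : ‖cexp z‖ ≤ Real.exp |z.re| := by
    rw [norm_exp, Real.exp_le_exp]
    exact le_abs_self _
  have h₂ : ‖cexp (-z)‖ ≤ Real.exp |z.re| := by
    rw [norm_exp, neg_re, Real.exp_le_exp]
    exact neg_le_abs _
  rw [Complex.cosh, norm_div, Complex.norm_ofNat]
  linarith [norm_add_le (cexp z) (cexp (-z))]

lemma norm_cexp_neg_mul_sinh (x ξ : ℝ) :
    ‖cexp (-(x * sinh ξ))‖ = Real.exp (-(x * Real.sinh ξ)) := by
  rw [norm_exp, ← ofReal_sinh, ← ofReal_mul, ← ofReal_neg, ofReal_re]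

lemma continuous_kPlusIntegral {x : ℝ} (hx : 0 < x) : Continuous (kPlusIntegral x) := by
  have continuous_Ioi : Continuous fun w : ℂ =>
      ∫ ξ in Set.Ioi (0 : ℝ), cexp (-(x * sinh ξ)) * cosh (w * ξ) := by
    refine continuous_iff_continuousAt.mpr fun w₀ => continuousAt_of_dominated
      (bound := fun ξ : ℝ => Real.exp (-(x * Real.sinh ξ)) * Real.exp ((‖w₀‖ + 1) * ξ))
      (Eventually.of_forall fun w => (by fun_prop : Continuous _).aestronglyMeasurable) ?_
      (integrableOn_exp_neg_mul_sinh_mul_exp hx _)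
      (ae_of_all _ fun ξ => (by fun_prop : Continuous _).continuousAt)
    filter_upwards [Metric.ball_mem_nhds w₀ one_pos] with w hw
    filter_upwards [ae_restrict_mem measurableSet_Ioi] with ξ hξ
    rw [norm_mul, norm_cexp_neg_mul_sinh]
    gcongr
    refine (norm_cosh_le_exp_abs_re _).trans (Real.exp_le_exp.mpr ?_)
    rw [re_mul_ofReal, abs_mul, abs_of_pos (Set.mem_Ioi.mp hξ)]
    gcongr
    · exact le_of_lt hξ
    · linarith [abs_re_le_norm w, norm_le_norm_add_norm_sub w₀ w, mem_ball_iff_norm'.mp hw]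
  have continuous_circle : Continuous fun w : ℂ =>
      ∫ φ in (0 : ℝ)..(π / 2), cos (w * φ) * sin (x * cos φ) :=
    intervalIntegral.continuous_parametric_intervalIntegral_of_continuous' (by fun_prop) _ _
  exact continuous_const.mul (((by fun_prop : Continuous fun w : ℂ => cos (π * w / 2)).mul
    continuous_Ioi).sub continuous_circle)

lemma integral_Ioi_cexp_neg_mul_sinh_add {x : ℝ} (hx : 0 < x) (w : ℂ) :
    (∫ ξ in Set.Ioi (0 : ℝ), cexp (-(x * sinh ξ)) * cexp (-w * ξ)) +
        (∫ ξ in Set.Ioi (0 : ℝ), cexp (-(x * sinh ξ)) * cexp (- -w * ξ)) =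
      2 * ∫ ξ in Set.Ioi (0 : ℝ), cexp (-(x * sinh ξ)) * cosh (w * ξ) := by
  have integrableOn (a : ℂ) :
      IntegrableOn (fun ξ : ℝ => cexp (-(x * sinh ξ)) * cexp (a * ξ)) (Set.Ioi 0) := by
    refine (integrableOn_exp_neg_mul_sinh_mul_exp hx a.re).mono'
      (by fun_prop : Continuous _).aestronglyMeasurable (ae_of_all _ fun ξ => le_of_eq ?_)
    rw [norm_mul, norm_cexp_neg_mul_sinh, norm_exp, re_mul_ofReal]
  rw [← integral_add (integrableOn _) (integrableOn _), ← integral_const_mul]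
  congr 1 with ξ
  rw [Complex.cosh, neg_neg, neg_mul]
  ring

lemma besselJ_sub_besselJ_neg {x : ℝ} (hx : 0 < x) (w : ℂ) :
    besselJ w x - besselJ (-w) x = -2 * sin (π * w / 2) * kPlusIntegral x w := by
  have sin_pi_mul : sin (π * w) = 2 * sin (π * w / 2) * cos (π * w / 2) := by
    rw [← sin_two_mul, mul_div_cancel₀ _ two_ne_zero]
  have circle := integral_cexp_sin_sub x w
  rw [integral_sin_mul_sin_mul_sin] at circle
  rw [besselJ_eq_integral hx, besselJ_eq_integral hx, kPlusIntegral, mul_neg, Complex.sin_neg,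
    sin_pi_mul]
  linear_combination 1 / (2 * π) * circle -
    2 * sin (π * w / 2) * cos (π * w / 2) / π * integral_Ioi_cexp_neg_mul_sinh_add hx w

lemma cos_pi_mul_eq_neg_sin (v : ℂ) : cos (π * v) = -sin (π * (2 * v - 1) / 2) := by
  rw [show (π * (2 * v - 1) / 2 : ℂ) = π * v - π / 2 by ring, sin_sub_pi_div_two, neg_neg]

lemma kPlusQuot_eq_kPlusIntegral {x : ℝ} (hx : 0 < x) {v : ℂ} (hv : cos (π * v) ≠ 0) :
    kPlusQuot x v = kPlusIntegral x (2 * v - 1) := by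
  rw [kPlusQuot, show 1 - 2 * v = -(2 * v - 1) by ring, besselJ_sub_besselJ_neg hx]
  have sin_eq := neg_eq_iff_eq_neg.mp (cos_pi_mul_eq_neg_sin v).symm
  rw [sin_eq]
  field_simp

lemma eventually_cos_pi_mul_ne_zero (v : ℂ) : ∀ᶠ u in 𝓝[≠] v, cos (π * u) ≠ 0 := by
  by_cases hv : cos (π * v) = 0
  · have sin_ne_zero : sin (π * v) ≠ 0 := fun h => by simpa [h, hv] using sin_sq_add_cos_sq (π * v)
    have hasDerivAt_cos : HasDerivAt (fun u : ℂ => cos (π * u)) (-sin (π * v) * (π * 1)) v :=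
      ((hasDerivAt_id v).const_mul (π : ℂ)).ccos
    exact hasDerivAt_cos.eventually_ne (by simp [sin_ne_zero, Real.pi_ne_zero])
  · have continuous_cos : Continuous fun u : ℂ => cos (π * u) := by fun_prop
    exact (continuous_cos.continuousAt.eventually_ne hv).filter_mono nhdsWithin_le_nhds

theorem kPlus_eq_kPlusIntegral {x : ℝ} (hx : 0 < x) (v : ℂ) :
    kPlus x v = kPlusIntegral x (2 * v - 1) := by
  rw [kPlus]
  split_ifs with hv
  · have tendsto_integral : Tendsto (fun u => kPlusIntegral x (2 * u - 1)) (𝓝[≠] v)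
        (𝓝 (kPlusIntegral x (2 * v - 1))) :=
      ((continuous_kPlusIntegral hx).comp (by fun_prop : Continuous fun u : ℂ => 2 * u - 1)
        |>.tendsto v).mono_left nhdsWithin_le_nhds
    exact (tendsto_integral.congr' ((eventually_cos_pi_mul_ne_zero v).mono
      fun u hu => (kPlusQuot_eq_kPlusIntegral hx hu).symm)).limUnder_eq
  · exact kPlusQuot_eq_kPlusIntegral hx hv

end Schlafli

section MehlerSonine

open Complex

/-- The real value of `k⁺(x, 1/2 + it)`, see `kPlus_eq_kPlusReal`. -/
def kPlusReal (t x : ℝ) : ℝ :=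
  2 / π * (Real.cosh (π * t) *
      (∫ ξ in Set.Ioi (0 : ℝ), Real.exp (-(x * Real.sinh ξ)) * Real.cos (2 * t * ξ)) -
    ∫ φ in (0 : ℝ)..(π / 2), Real.cosh (2 * t * φ) * Real.sin (x * Real.cos φ))

/-- The truncation at height `T` of the Mehler–Sonine integral for `k⁺(x, 1/2 + it)`, whose full
range of integration gives a conditionally convergent integral. -/
def kPlusTrunc (t T x : ℝ) : ℝ :=
  2 / π * ∫ ξ in (0 : ℝ)..T, Real.cos (x * Real.cosh ξ) * Real.cos (2 * t * ξ)

/-- The entire function whose integrals along the edges of the rectangle with opposite vertices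
`0` and `T + iπ/2` compare `kPlusTrunc` with `kPlusReal`. -/
def mehlerSonineIntegrand (t x : ℝ) (ζ : ℂ) : ℂ :=
  cexp (I * (x * cosh ζ)) * cosh (2 * t * I * ζ)

lemma kPlus_eq_kPlusReal {x : ℝ} (hx : 0 < x) (t : ℝ) :
    kPlus x (1 / 2 + t * I) = (kPlusReal t x : ℂ) := by
  have exp_mul_cosh (ξ : ℝ) : cexp (-(x * sinh ξ)) * cosh (2 * t * I * ξ) =
      ((Real.exp (-(x * Real.sinh ξ)) * Real.cos (2 * t * ξ) : ℝ) : ℂ) := by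
    push_cast
    rw [show 2 * t * I * (ξ : ℂ) = 2 * t * ξ * I by ring, cosh_mul_I]
  have cos_mul_sin (φ : ℝ) : cos (2 * t * I * φ) * sin (x * cos φ) =
      ((Real.cosh (2 * t * φ) * Real.sin (x * Real.cos φ) : ℝ) : ℂ) := by
    push_cast
    rw [show 2 * t * I * (φ : ℂ) = 2 * t * φ * I by ring, cos_mul_I]
  rw [kPlus_eq_kPlusIntegral hx, show 2 * (1 / 2 + t * I) - 1 = 2 * t * I by ring,
    kPlusIntegral, kPlusReal]
  simp only [exp_mul_cosh, cos_mul_sin]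
  rw [integral_complex_ofReal, intervalIntegral.integral_ofReal,
    show (π * (2 * t * I) / 2 : ℂ) = π * t * I by ring, cos_mul_I]
  push_cast
  rfl

lemma continuous_mehlerSonineIntegrand (t x : ℝ) : Continuous (mehlerSonineIntegrand t x) := by
  unfold mehlerSonineIntegrand
  fun_prop

lemma mehlerSonineIntegrand_ofReal_re (t x ξ : ℝ) :
    (mehlerSonineIntegrand t x ξ).re = Real.cos (x * Real.cosh ξ) * Real.cos (2 * t * ξ) := by
  rw [mehlerSonineIntegrand, show 2 * t * I * (ξ : ℂ) = (2 * t * ξ : ℝ) * I by push_cast; ring,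
    cosh_mul_I, ← ofReal_cosh, ← ofReal_mul, mul_comm I, ← ofReal_cos, re_mul_ofReal,
    exp_ofReal_mul_I_re]

lemma mehlerSonineIntegrand_ofReal_mul_I_im (t x φ : ℝ) :
    (mehlerSonineIntegrand t x (φ * I)).im =
      Real.cosh (2 * t * φ) * Real.sin (x * Real.cos φ) := by
  rw [mehlerSonineIntegrand, cosh_mul_I, ← ofReal_cos, ← ofReal_mul, mul_comm I,
    show 2 * t * I * (φ * I) = ((-(2 * t * φ) : ℝ) : ℂ) by
      push_cast; linear_combination 2 * t * φ * I_sq,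
    ← ofReal_cosh, im_mul_ofReal, exp_ofReal_mul_I_im, Real.cosh_neg, mul_comm]

lemma mehlerSonineIntegrand_add_pi_div_two_mul_I_re (t x ξ : ℝ) :
    (mehlerSonineIntegrand t x (ξ + (π / 2 : ℝ) * I)).re =
      Real.cosh (π * t) * (Real.exp (-(x * Real.sinh ξ)) * Real.cos (2 * t * ξ)) := by
  have cosh_add : cosh (ξ + (π / 2 : ℝ) * I) = I * (Real.sinh ξ : ℝ) := by
    rw [Complex.cosh_add, cosh_mul_I, sinh_mul_I, ← ofReal_cos, ← ofReal_sin,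
      Real.cos_pi_div_two, Real.sin_pi_div_two]
    push_cast
    ring
  have exponent_eq : I * (x * (I * (Real.sinh ξ : ℝ))) = ((-(x * Real.sinh ξ) : ℝ) : ℂ) := by
    push_cast
    linear_combination x * sinh ξ * I_sq
  have argument_eq : 2 * t * I * (ξ + (π / 2 : ℝ) * I) =
      (-(π * t) : ℝ) + (2 * t * ξ : ℝ) * I := by
    push_cast
    linear_combination π * t * I_sq
  rw [mehlerSonineIntegrand, cosh_add, exponent_eq, argument_eq, Complex.cosh_add, cosh_mul_I,
    sinh_mul_I, ← ofReal_exp, re_ofReal_mul, ← ofReal_cosh, ← ofReal_sinh, ← ofReal_cos,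
    ← ofReal_sin, Real.cosh_neg]
  simp only [add_re, mul_re, ofReal_re, ofReal_im, I_re, I_im]
  ring

lemma re_intervalIntegral {f : ℝ → ℂ} (hf : Continuous f) (a b : ℝ) :
    (∫ y in a..b, f y).re = ∫ y in a..b, (f y).re :=
  (reCLM.intervalIntegral_comp_comm (hf.intervalIntegrable a b)).symm

lemma im_intervalIntegral {f : ℝ → ℂ} (hf : Continuous f) (a b : ℝ) :
    (∫ y in a..b, f y).im = ∫ y in a..b, (f y).im :=
  (imCLM.intervalIntegral_comp_comm (hf.intervalIntegrable a b)).symm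

lemma integral_mehlerSonineIntegrand_rectangle (t x T : ℝ) :
    (∫ ξ in (0 : ℝ)..T, Real.cos (x * Real.cosh ξ) * Real.cos (2 * t * ξ)) -
      (Real.cosh (π * t) *
        (∫ ξ in (0 : ℝ)..T, Real.exp (-(x * Real.sinh ξ)) * Real.cos (2 * t * ξ)) -
      ∫ φ in (0 : ℝ)..(π / 2), Real.cosh (2 * t * φ) * Real.sin (x * Real.cos φ)) =
      -(I * ∫ y in (0 : ℝ)..(π / 2), mehlerSonineIntegrand t x (T + y * I)).re := by
  have cont := continuous_mehlerSonineIntegrand t x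
  have boundary_eq_zero := congrArg re <|
    integral_boundary_rect_eq_zero_of_differentiableOn (mehlerSonineIntegrand t x) 0
      (T + (π / 2 : ℝ) * I) (Differentiable.differentiableOn (by
        unfold mehlerSonineIntegrand
        fun_prop))
  simp only [zero_re, zero_im, ofReal_zero, zero_mul, add_zero, add_re, ofReal_re, mul_re, I_re,
    mul_zero, ofReal_im, I_im, mul_one, sub_self, add_im, mul_im, zero_add, zero_sub, one_mul,
    smul_eq_mul, sub_re] at boundary_eq_zero
  rw [re_intervalIntegral (by fun_prop), re_intervalIntegral (by fun_prop),
    im_intervalIntegral (f := fun y : ℝ => mehlerSonineIntegrand t x (y * I)) (by fun_prop)]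
    at boundary_eq_zero
  simp only [mehlerSonineIntegrand_ofReal_re, mehlerSonineIntegrand_add_pi_div_two_mul_I_re,
    mehlerSonineIntegrand_ofReal_mul_I_im, intervalIntegral.integral_const_mul]
    at boundary_eq_zero
  rw [I_mul_re]
  linarith

lemma integral_exp_neg_mul_le {c : ℝ} (hc : 0 < c) (b : ℝ) :
    ∫ y in (0 : ℝ)..b, Real.exp (-(c * y)) ≤ 1 / c := by
  have integral_eq : ∫ y in (0 : ℝ)..b, Real.exp (-(c * y)) = (1 - Real.exp (-(c * b))) / c := by
    simp only [← neg_mul]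
    rw [intervalIntegral.integral_comp_mul_left _ (neg_ne_zero.mpr hc.ne'), integral_exp]
    simp only [mul_zero, Real.exp_zero, smul_eq_mul]
    field_simp
    ring
  rw [integral_eq]
  gcongr
  linarith [Real.exp_pos (-(c * b))]

lemma norm_mehlerSonineIntegrand_le {x T y : ℝ} (hx : 0 ≤ x) (hT : 0 ≤ T) (hy : 0 ≤ y)
    (hy' : y ≤ π / 2) (t : ℝ) :
    ‖mehlerSonineIntegrand t x (T + y * I)‖ ≤
      Real.exp (π * |t|) * Real.exp (-(x * Real.sinh T * (2 / π) * y)) := by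
  have re_exponent : (I * (x * cosh (T + y * I))).re = -(x * (Real.sinh T * Real.sin y)) := by
    rw [Complex.cosh_add, cosh_mul_I, sinh_mul_I, ← ofReal_cosh, ← ofReal_sinh, ← ofReal_cos,
      ← ofReal_sin]
    simp [-ofReal_cosh, -ofReal_sinh, -ofReal_cos, -ofReal_sin]
  have re_argument : (2 * t * I * (T + y * I)).re = -(2 * t * y) := by simp
  have abs_argument_le : |2 * t * y| ≤ π * |t| := by
    rw [abs_mul, abs_mul, abs_of_nonneg hy, abs_two]
    nlinarith [abs_nonneg t]
  have jordan : x * Real.sinh T * (2 / π * y) ≤ x * Real.sinh T * Real.sin y :=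
    mul_le_mul_of_nonneg_left (Real.mul_le_sin hy hy')
      (mul_nonneg hx (Real.sinh_nonneg_iff.mpr hT))
  rw [mehlerSonineIntegrand, norm_mul, mul_comm]
  gcongr
  · refine (norm_cosh_le_exp_abs_re _).trans (Real.exp_le_exp.mpr ?_)
    rwa [re_argument, abs_neg]
  · rw [norm_exp, Real.exp_le_exp, re_exponent]
    linarith

lemma norm_integral_mehlerSonineIntegrand_le {x T : ℝ} (hx : 0 < x) (hT : 0 < T) (t : ℝ) :
    ‖∫ y in (0 : ℝ)..(π / 2), mehlerSonineIntegrand t x (T + y * I)‖ ≤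
      Real.exp (π * |t|) * (π / 2) / (x * Real.sinh T) := by
  have rate_pos : 0 < x * Real.sinh T * (2 / π) := by positivity
  calc ‖∫ y in (0 : ℝ)..(π / 2), mehlerSonineIntegrand t x (T + y * I)‖
      ≤ ∫ y in (0 : ℝ)..(π / 2),
          Real.exp (π * |t|) * Real.exp (-(x * Real.sinh T * (2 / π) * y)) :=
        intervalIntegral.norm_integral_le_of_norm_le (by positivity)
          (ae_of_all _ fun y hy => norm_mehlerSonineIntegrand_le hx.le hT.le hy.1.le hy.2 t)
          ((by fun_prop : Continuous _).intervalIntegrable _ _)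
    _ ≤ Real.exp (π * |t|) * (1 / (x * Real.sinh T * (2 / π))) := by
        rw [intervalIntegral.integral_const_mul]
        gcongr
        exact integral_exp_neg_mul_le rate_pos _
    _ = _ := by field_simp

lemma exp_neg_mul_sinh_le {x T ξ : ℝ} (hx : 0 < x) (hT : 0 < T) (hξ : T ≤ ξ) :
    Real.exp (-(x * Real.sinh ξ)) ≤ Real.exp T / (x * Real.sinh T) * Real.exp (-ξ) := by
  have sinh_mul_exp_le : Real.sinh T * Real.exp (ξ - T) ≤ Real.sinh ξ := by
    rw [← sub_add_cancel ξ T, Real.sinh_add, add_sub_cancel_right, ← Real.cosh_add_sinh, mul_add]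
    nlinarith [Real.sinh_lt_cosh T, Real.sinh_nonneg_iff.mpr (sub_nonneg.mpr hξ)]
  have le_exp : x * (Real.sinh T * Real.exp (ξ - T)) ≤ Real.exp (x * Real.sinh ξ) :=
    (mul_le_mul_of_nonneg_left sinh_mul_exp_le hx.le).trans
      (by linarith [Real.add_one_le_exp (x * Real.sinh ξ)])
  calc Real.exp (-(x * Real.sinh ξ)) ≤ (x * (Real.sinh T * Real.exp (ξ - T)))⁻¹ := by
        rw [Real.exp_neg]
        exact inv_anti₀ (by positivity) le_exp
    _ = _ := by
        rw [Real.exp_sub, Real.exp_neg]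
        field_simp

lemma abs_integral_Ioi_exp_neg_mul_sinh_mul_cos_le {x T : ℝ} (hx : 0 < x) (hT : 0 < T) (a : ℝ) :
    |∫ ξ in Set.Ioi T, Real.exp (-(x * Real.sinh ξ)) * Real.cos (a * ξ)| ≤
      1 / (x * Real.sinh T) :=
  calc |∫ ξ in Set.Ioi T, Real.exp (-(x * Real.sinh ξ)) * Real.cos (a * ξ)|
      ≤ ∫ ξ in Set.Ioi T, Real.exp T / (x * Real.sinh T) * Real.exp (-ξ) := by
        rw [← Real.norm_eq_abs]
        refine norm_integral_le_of_norm_le ((integrableOn_exp_neg_Ioi T).const_mul _) ?_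
        refine (ae_restrict_mem measurableSet_Ioi).mono fun ξ hξ => ?_
        rw [norm_mul, Real.norm_of_nonneg (Real.exp_pos _).le]
        exact (mul_le_of_le_one_right (Real.exp_pos _).le (Real.abs_cos_le_one _)).trans
          (exp_neg_mul_sinh_le hx hT (le_of_lt hξ))
    _ = 1 / (x * Real.sinh T) := by
        rw [integral_const_mul, integral_exp_neg_Ioi, Real.exp_neg]
        field_simp

lemma integrableOn_exp_neg_mul_sinh_mul_cos {x : ℝ} (hx : 0 < x) (a : ℝ) :
    IntegrableOn (fun ξ : ℝ => Real.exp (-(x * Real.sinh ξ)) * Real.cos (a * ξ)) (Set.Ioi 0) := by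
  refine (integrableOn_exp_neg_mul_sinh_mul_exp hx 0).mono'
    (by fun_prop : Continuous _).aestronglyMeasurable (ae_of_all _ fun ξ => ?_)
  rw [norm_mul, Real.norm_of_nonneg (Real.exp_pos _).le, zero_mul, Real.exp_zero]
  gcongr
  exact Real.abs_cos_le_one _

theorem exists_abs_kPlusReal_sub_kPlusTrunc_le (t : ℝ) :
    ∃ C : ℝ, 0 ≤ C ∧ ∀ x T : ℝ, 0 < x → 0 < T →
      |kPlusReal t x - kPlusTrunc t T x| ≤ C / (x * Real.sinh T) := by
  refine ⟨2 / π * (Real.cosh (π * t) + Real.exp (π * |t|) * (π / 2)), by positivity,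
    fun x T hx hT => ?_⟩
  have integrable := integrableOn_exp_neg_mul_sinh_mul_cos hx (2 * t)
  rw [kPlusReal, kPlusTrunc, ← intervalIntegral.integral_interval_add_Ioi integrable
      (integrable.mono_set (Set.Ioi_subset_Ioi hT.le)), ← mul_sub, abs_mul,
    abs_of_pos (by positivity), mul_div_assoc]
  gcongr
  have rectangle := integral_mehlerSonineIntegrand_rectangle t x T
  have tail_le := abs_integral_Ioi_exp_neg_mul_sinh_mul_cos_le hx hT (2 * t)
  have edge_le := (abs_re_le_norm
    (I * ∫ y in (0 : ℝ)..(π / 2), mehlerSonineIntegrand t x (T + y * I))).trans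
      (by simpa using norm_integral_mehlerSonineIntegrand_le hx hT t)
  set edge := (I * ∫ y in (0 : ℝ)..(π / 2), mehlerSonineIntegrand t x (T + y * I)).re
  set tail := ∫ ξ in Set.Ioi T, Real.exp (-(x * Real.sinh ξ)) * Real.cos (2 * t * ξ)
  calc _ = |Real.cosh (π * t) * tail + edge| := by
        congr 1
        linear_combination -rectangle
    _ ≤ Real.cosh (π * t) * |tail| + |edge| := by
        refine (abs_add_le _ _).trans_eq ?_
        rw [abs_mul, abs_of_pos (Real.cosh_pos _)]
    _ ≤ Real.cosh (π * t) * (1 / (x * Real.sinh T)) +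
        Real.exp (π * |t|) * (π / 2) / (x * Real.sinh T) := by gcongr
    _ = _ := by ring

end MehlerSonine

section BesselIntegral

/-- Bessel's integral for the Bessel function of integer order `n`, see `besselJ_natCast`. Unlike
`besselJ` it is real-valued and makes sense at all real arguments. -/
def besselInt (n : ℕ) (x : ℝ) : ℝ :=
  1 / (2 * π) * ∫ θ in (-π)..π, Real.cos (x * Real.sin θ - n * θ)

/-- The derivative of `besselInt n`, in the form given by differentiation under the integral. -/
def besselIntDeriv (n : ℕ) (x : ℝ) : ℝ :=
  1 / (2 * π) * ∫ θ in (-π)..π, -(Real.sin θ * Real.sin (x * Real.sin θ - n * θ))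

/-- The second derivative of `besselInt n`, in the form given by differentiation under the
integral. -/
def besselIntDerivTwo (n : ℕ) (x : ℝ) : ℝ :=
  1 / (2 * π) * ∫ θ in (-π)..π, -(Real.sin θ ^ 2 * Real.cos (x * Real.sin θ - n * θ))

open Complex in
lemma ofReal_besselInt (n : ℕ) (x : ℝ) :
    (besselInt n x : ℂ) = 1 / (2 * π) * ∫ θ in (-π)..π, cexp (I * (x * sin θ - n * θ)) := by
  have cexp_fold := integral_eq_integral_sub_add
    (f := fun θ : ℝ => cexp (I * (x * sin θ - n * θ))) (by fun_prop) 0 π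
  have cos_fold := integral_eq_integral_sub_add
    (f := fun θ : ℝ => ((Real.cos (x * Real.sin θ - n * θ) : ℝ) : ℂ)) (by fun_prop) 0 π
  simp only [zero_sub, zero_add] at cexp_fold cos_fold
  rw [besselInt, ofReal_mul, ← intervalIntegral.integral_ofReal, cexp_fold, cos_fold]
  push_cast
  congr 2
  ext φ
  rw [Complex.sin_neg, show I * (x * -sin φ - n * -φ) = -(x * sin φ - n * φ) * I by ring,
    show I * (x * sin φ - n * φ) = (x * sin φ - n * φ) * I by ring,
    show (x * -sin φ - n * -φ : ℂ) = -(x * sin φ - n * φ) by ring, Complex.cos_neg, Complex.cos]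
  ring

theorem besselJ_natCast {x : ℝ} (hx : 0 < x) (n : ℕ) : besselJ n x = (besselInt n x : ℂ) := by
  rw [besselJ_eq_integral hx, mul_comm (π : ℂ), Complex.sin_nat_mul_pi, ofReal_besselInt, zero_div,
    zero_mul, sub_zero]

lemma hasDerivAt_intervalIntegral_of_abs_deriv_le {F F' : ℝ → ℝ → ℝ} {C : ℝ}
    (hF : ∀ x, Continuous (F x)) (hF' : ∀ x, Continuous (F' x)) (bound : ∀ x θ, |F' x θ| ≤ C)
    (hasDerivAt : ∀ x θ, HasDerivAt (F · θ) (F' x θ) x) (a b x : ℝ) :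
    HasDerivAt (fun x => ∫ θ in a..b, F x θ) (∫ θ in a..b, F' x θ) x :=
  (intervalIntegral.hasDerivAt_integral_of_dominated_loc_of_deriv_le (bound := fun _ => C)
    univ_mem (Eventually.of_forall fun x => (hF x).aestronglyMeasurable)
    ((hF x).intervalIntegrable _ _) (hF' x).aestronglyMeasurable
    (ae_of_all _ fun θ _ x _ => bound x θ) intervalIntegrable_const
    (ae_of_all _ fun θ _ x _ => hasDerivAt x θ)).2

lemma hasDerivAt_besselInt (n : ℕ) (x : ℝ) :
    HasDerivAt (besselInt n) (besselIntDeriv n x) x := by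
  refine HasDerivAt.const_mul _ ?_
  refine hasDerivAt_intervalIntegral_of_abs_deriv_le (C := 1)
    (F' := fun x θ => -(Real.sin θ * Real.sin (x * Real.sin θ - n * θ)))
    (fun x => by fun_prop) (fun x => by fun_prop) (fun x θ => ?_) (fun x θ => ?_) _ _ x
  · rw [abs_neg, abs_mul]
    exact mul_le_one₀ (Real.abs_sin_le_one _) (abs_nonneg _) (Real.abs_sin_le_one _)
  · refine (((hasDerivAt_id' x).mul_const (Real.sin θ)).sub_const (n * θ)).cos.congr_deriv ?_
    ring

lemma hasDerivAt_besselIntDeriv (n : ℕ) (x : ℝ) :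
    HasDerivAt (besselIntDeriv n) (besselIntDerivTwo n x) x := by
  refine HasDerivAt.const_mul _ ?_
  refine hasDerivAt_intervalIntegral_of_abs_deriv_le (C := 1)
    (F' := fun x θ => -(Real.sin θ ^ 2 * Real.cos (x * Real.sin θ - n * θ)))
    (fun x => by fun_prop) (fun x => by fun_prop) (fun x θ => ?_) (fun x θ => ?_) _ _ x
  · rw [abs_neg, abs_mul, abs_pow]
    exact mul_le_one₀ (pow_le_one₀ (abs_nonneg _) (Real.abs_sin_le_one _)) (abs_nonneg _)
      (Real.abs_cos_le_one _)
  · refine ((((hasDerivAt_id' x).mul_const (Real.sin θ)).sub_const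
      (n * θ)).sin.const_mul (Real.sin θ)).neg.congr_deriv ?_
    ring

@[fun_prop]
lemma continuous_besselInt (n : ℕ) : Continuous (besselInt n) :=
  continuous_iff_continuousAt.mpr fun x => (hasDerivAt_besselInt n x).continuousAt

@[fun_prop]
lemma continuous_besselIntDeriv (n : ℕ) : Continuous (besselIntDeriv n) :=
  continuous_iff_continuousAt.mpr fun x => (hasDerivAt_besselIntDeriv n x).continuousAt

lemma abs_average_le {f : ℝ → ℝ} {C : ℝ} (hf : ∀ θ, |f θ| ≤ C) :
    |1 / (2 * π) * ∫ θ in (-π)..π, f θ| ≤ C := by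
  have norm_integral_le := intervalIntegral.norm_integral_le_of_norm_le_const
    (a := -π) (b := π) (f := f) fun θ _ => hf θ
  rw [sub_neg_eq_add, ← two_mul, abs_of_pos Real.two_pi_pos, Real.norm_eq_abs] at norm_integral_le
  rwa [abs_mul, abs_of_pos (by positivity), one_div, inv_mul_le_iff₀ Real.two_pi_pos, mul_comm]

lemma abs_besselInt_le_one (n : ℕ) (x : ℝ) : |besselInt n x| ≤ 1 :=
  abs_average_le fun _ => Real.abs_cos_le_one _

lemma abs_besselIntDeriv_le_one (n : ℕ) (x : ℝ) : |besselIntDeriv n x| ≤ 1 := by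
  refine abs_average_le fun θ => ?_
  rw [abs_neg, abs_mul]
  exact mul_le_one₀ (Real.abs_sin_le_one _) (abs_nonneg _) (Real.abs_sin_le_one _)

lemma besselInt_zero {n : ℕ} (hn : n ≠ 0) : besselInt n 0 = 0 := by
  simp only [besselInt, zero_mul, zero_sub, Real.cos_neg]
  rw [intervalIntegral.integral_comp_mul_left _ (Nat.cast_ne_zero.mpr hn), integral_cos]
  simp [Real.sin_nat_mul_pi]

lemma abs_besselInt_le {n : ℕ} (hn : n ≠ 0) (x : ℝ) : |besselInt n x| ≤ |x| := by
  simpa [besselInt_zero hn] using convex_univ.norm_image_sub_le_of_norm_hasDerivWithin_le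
    (fun x _ => (hasDerivAt_besselInt n x).hasDerivWithinAt)
    (fun x _ => abs_besselIntDeriv_le_one n x) (Set.mem_univ 0) (Set.mem_univ x)

theorem besselInt_ode (n : ℕ) (x : ℝ) :
    x ^ 2 * besselIntDerivTwo n x + x * besselIntDeriv n x +
      (x ^ 2 - n ^ 2) * besselInt n x = 0 := by
  have hasDerivAt_primitive : ∀ θ ∈ Set.uIcc (-π) π,
      HasDerivAt (fun θ : ℝ => (n + x * Real.cos θ) * Real.sin (x * Real.sin θ - n * θ))
        (x ^ 2 * -(Real.sin θ ^ 2 * Real.cos (x * Real.sin θ - n * θ)) +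
          x * -(Real.sin θ * Real.sin (x * Real.sin θ - n * θ)) +
          (x ^ 2 - n ^ 2) * Real.cos (x * Real.sin θ - n * θ)) θ := by
    intro θ _
    refine ((((Real.hasDerivAt_cos θ).const_mul x).const_add (n : ℝ)).mul
      (((Real.hasDerivAt_sin θ).const_mul x).sub
        ((hasDerivAt_id' θ).const_mul (n : ℝ))).sin).congr_deriv ?_
    simp only [Pi.sub_apply]
    linear_combination x ^ 2 * Real.cos (x * Real.sin θ - n * θ) * Real.sin_sq_add_cos_sq θ
  have integral_eq_zero := intervalIntegral.integral_eq_sub_of_hasDerivAt hasDerivAt_primitive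
    ((by fun_prop : Continuous _).intervalIntegrable _ _)
  rw [intervalIntegral.integral_add ((by fun_prop : Continuous _).intervalIntegrable _ _)
      ((by fun_prop : Continuous _).intervalIntegrable _ _),
    intervalIntegral.integral_add ((by fun_prop : Continuous _).intervalIntegrable _ _)
      ((by fun_prop : Continuous _).intervalIntegrable _ _)] at integral_eq_zero
  simp only [intervalIntegral.integral_const_mul, Real.sin_pi, Real.sin_neg, mul_zero, neg_zero,
    zero_sub, mul_neg, sub_neg_eq_add, zero_add, Real.sin_nat_mul_pi, sub_self,
    intervalIntegral.integral_neg] at integral_eq_zero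
  simp only [besselInt, besselIntDeriv, besselIntDerivTwo, intervalIntegral.integral_neg]
  linear_combination 1 / (2 * π) * integral_eq_zero

lemma besselIntDerivTwo_eq (n : ℕ) {x : ℝ} (hx : x ≠ 0) :
    besselIntDerivTwo n x = -(besselIntDeriv n x / x) - (1 - n ^ 2 / x ^ 2) * besselInt n x := by
  field_simp
  linear_combination besselInt_ode n x

/-- A Lyapunov function for Bessel's equation. The cross term makes the derivative of the energy
`x (J² + J'²)` smaller by a factor `x`, so that it becomes integrable at infinity. -/
def besselEnergy (n : ℕ) (x : ℝ) : ℝ :=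
  x * besselIntDeriv n x ^ 2 + x * besselInt n x ^ 2 + besselInt n x * besselIntDeriv n x

lemma half_mul_sq_add_sq_le {x : ℝ} (hx : 1 ≤ x) (j d : ℝ) :
    x / 2 * (j ^ 2 + d ^ 2) ≤ x * d ^ 2 + x * j ^ 2 + j * d := by
  nlinarith [sq_nonneg (j + d),
    mul_nonneg (sub_nonneg.mpr hx) (add_nonneg (sq_nonneg j) (sq_nonneg d))]

lemma besselEnergy_nonneg (n : ℕ) {x : ℝ} (hx : 1 ≤ x) : 0 ≤ besselEnergy n x :=
  le_trans (by positivity) (half_mul_sq_add_sq_le hx _ _)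

lemma besselEnergy_one_le (n : ℕ) : besselEnergy n 1 ≤ 3 := by
  have J_bounds := abs_le.mp (abs_besselInt_le_one n 1)
  have J'_bounds := abs_le.mp (abs_besselIntDeriv_le_one n 1)
  unfold besselEnergy
  nlinarith

lemma hasDerivAt_besselEnergy (n : ℕ) {x : ℝ} (hx : x ≠ 0) :
    HasDerivAt (besselEnergy n)
      ((2 * n ^ 2 - 1) * (besselInt n x * besselIntDeriv n x) / x +
        n ^ 2 * besselInt n x ^ 2 / x ^ 2) x := by
  have hJ := hasDerivAt_besselInt n x
  have hJ' := hasDerivAt_besselIntDeriv n x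
  refine ((((hasDerivAt_id' x).mul (hJ'.pow 2)).add
    ((hasDerivAt_id' x).mul (hJ.pow 2))).add (hJ.mul hJ')).congr_deriv ?_
  simp only [Pi.pow_apply, besselIntDerivTwo_eq n hx]
  field_simp
  ring

lemma energy_rate_le {x N : ℝ} (hx : 1 ≤ x) (hN : 0 ≤ N) (j d : ℝ) :
    (2 * N - 1) * (j * d) / x + N * j ^ 2 / x ^ 2 ≤
      (4 * N + 2) * (x * d ^ 2 + x * j ^ 2 + j * d) / x ^ 2 := by
  have cross_term_le : (2 * N - 1) * (j * d) ≤ (N + 1) * (j ^ 2 + d ^ 2) := by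
    nlinarith [mul_nonneg hN (sq_nonneg (j - d)), sq_nonneg (j + d), sq_nonneg j, sq_nonneg d]
  have sq_term_le : N * j ^ 2 ≤ x * (N * (j ^ 2 + d ^ 2)) :=
    (mul_le_mul_of_nonneg_left (le_add_of_nonneg_right (sq_nonneg d)) hN).trans
      (le_mul_of_one_le_left (by positivity) hx)
  rw [show (2 * N - 1) * (j * d) / x = x * ((2 * N - 1) * (j * d)) / x ^ 2 by field_simp,
    ← add_div]
  gcongr
  calc x * ((2 * N - 1) * (j * d)) + N * j ^ 2
      ≤ x * ((N + 1) * (j ^ 2 + d ^ 2)) + x * (N * (j ^ 2 + d ^ 2)) := by gcongr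
    _ = (4 * N + 2) * (x / 2 * (j ^ 2 + d ^ 2)) := by ring
    _ ≤ _ := by gcongr; exact half_mul_sq_add_sq_le hx j d

lemma mul_exp_div_le_of_deriv_le {f f' : ℝ → ℝ} {c x₀ : ℝ} (hx₀ : 0 < x₀)
    (hasDerivAt : ∀ x, x₀ ≤ x → HasDerivAt f (f' x) x)
    (deriv_le : ∀ x, x₀ ≤ x → f' x ≤ c * f x / x ^ 2) {x : ℝ} (hx : x₀ ≤ x) :
    f x * Real.exp (c / x) ≤ f x₀ * Real.exp (c / x₀) := by
  have hasDerivAt_mul_exp (x : ℝ) (hx : x₀ ≤ x) :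
      HasDerivAt (fun x => f x * Real.exp (c / x))
        ((f' x - c * f x / x ^ 2) * Real.exp (c / x)) x := by
    refine ((hasDerivAt x hx).mul ((hasDerivAt_const x c).div (hasDerivAt_id' x)
      (hx₀.trans_le hx).ne').exp).congr_deriv ?_
    simp only [Pi.div_apply]
    ring
  refine antitoneOn_of_hasDerivWithinAt_nonpos (convex_Ici x₀)
    (fun y hy => (hasDerivAt_mul_exp y hy).continuousAt.continuousWithinAt)
    (fun y hy => (hasDerivAt_mul_exp y (interior_subset hy)).hasDerivWithinAt)
    (fun y hy => mul_nonpos_of_nonpos_of_nonneg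
      (sub_nonpos.mpr (deriv_le y (interior_subset hy))) (Real.exp_pos _).le)
    Set.self_mem_Ici hx hx

lemma exists_besselInt_sq_add_sq_le (n : ℕ) : ∃ C : ℝ, 1 ≤ C ∧ ∀ x : ℝ, 1 ≤ x →
    besselInt n x ^ 2 + besselIntDeriv n x ^ 2 ≤ C / x := by
  set c : ℝ := 4 * n ^ 2 + 2
  have c_nonneg : 0 ≤ c := by positivity
  refine ⟨6 * Real.exp c, by linarith [Real.one_le_exp c_nonneg], fun x hx => ?_⟩
  have x_pos : 0 < x := one_pos.trans_le hx
  have energy_le : besselEnergy n x ≤ 3 * Real.exp c := calc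
    besselEnergy n x ≤ besselEnergy n x * Real.exp (c / x) :=
      le_mul_of_one_le_right (besselEnergy_nonneg n hx) (Real.one_le_exp (by positivity))
    _ ≤ besselEnergy n 1 * Real.exp (c / 1) :=
      mul_exp_div_le_of_deriv_le one_pos
        (fun y hy => hasDerivAt_besselEnergy n (one_pos.trans_le hy).ne')
        (fun y hy => energy_rate_le hy (sq_nonneg _) _ _) hx
    _ ≤ 3 * Real.exp c := by
      rw [div_one]
      exact mul_le_mul_of_nonneg_right (besselEnergy_one_le n) (Real.exp_pos _).le
  rw [le_div_iff₀ x_pos]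
  linarith [(half_mul_sq_add_sq_le hx (besselInt n x) (besselIntDeriv n x)).trans energy_le]

theorem exists_abs_besselInt_le_div_sqrt (n : ℕ) : ∃ D : ℝ, 0 < D ∧ ∀ x : ℝ, 0 < x →
    |besselInt n x| ≤ D / √x ∧ |besselIntDeriv n x| ≤ D / √x := by
  obtain ⟨C, hC, sq_add_sq_le⟩ := exists_besselInt_sq_add_sq_le n
  refine ⟨√C, Real.sqrt_pos.mpr (by linarith), fun x hx => ?_⟩
  rw [← Real.sqrt_div' _ hx.le]
  rcases le_total 1 x with one_le | le_one
  · have h := sq_add_sq_le x one_le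
    exact ⟨Real.abs_le_sqrt (by linarith [sq_nonneg (besselIntDeriv n x)]),
      Real.abs_le_sqrt (by linarith [sq_nonneg (besselInt n x)])⟩
  · have one_le_sqrt : 1 ≤ √(C / x) :=
      Real.one_le_sqrt.mpr ((one_le_div hx).mpr (le_one.trans hC))
    exact ⟨(abs_besselInt_le_one n x).trans one_le_sqrt,
      (abs_besselIntDeriv_le_one n x).trans one_le_sqrt⟩

end BesselIntegral

section CosTransform

/-- The truncated cosine transform of `besselInt n`. -/
def cosTransform (n : ℕ) (R a : ℝ) : ℝ :=
  ∫ x in (0 : ℝ)..R, besselInt n x * Real.cos (a * x)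

lemma intervalIntegrable_besselInt_mul_cos (n : ℕ) (a X R : ℝ) :
    IntervalIntegrable (fun x => besselInt n x * Real.cos (a * x)) volume X R :=
  (by fun_prop : Continuous _).intervalIntegrable _ _

/-- The boundary term produced by integrating `(1 - a²) besselInt n x cos (a x)` by parts. -/
def besselBoundary (n : ℕ) (a x : ℝ) : ℝ :=
  besselIntDeriv n x * Real.cos (a * x) + a * (besselInt n x * Real.sin (a * x))

/-- The contribution of the lower order terms of Bessel's equation to the derivative of
`besselBoundary`. -/
def besselRemainder (n : ℕ) (a x : ℝ) : ℝ :=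
  -(besselIntDeriv n x * Real.cos (a * x) / x) +
    n ^ 2 * (besselInt n x * Real.cos (a * x)) / x ^ 2

lemma hasDerivAt_besselBoundary (n : ℕ) (a : ℝ) {x : ℝ} (hx : x ≠ 0) :
    HasDerivAt (besselBoundary n a)
      (besselRemainder n a x - (1 - a ^ 2) * (besselInt n x * Real.cos (a * x))) x := by
  have hasDerivAt_mul := (hasDerivAt_id' x).const_mul a
  refine (((hasDerivAt_besselIntDeriv n x).mul hasDerivAt_mul.cos).add
    (((hasDerivAt_besselInt n x).mul hasDerivAt_mul.sin).const_mul a)).congr_deriv ?_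
  rw [besselIntDerivTwo_eq n hx, besselRemainder]
  field_simp
  ring

lemma intervalIntegrable_besselRemainder (n : ℕ) (a : ℝ) {X R : ℝ} (hX : 0 < X) (hXR : X ≤ R) :
    IntervalIntegrable (besselRemainder n a) volume X R := by
  have ne_zero : ∀ x ∈ Set.uIcc X R, x ≠ 0 := fun x hx =>
    (hX.trans_le (Set.uIcc_of_le hXR ▸ hx).1).ne'
  exact ContinuousOn.intervalIntegrable <|
    (ContinuousOn.div (by fun_prop) (by fun_prop) ne_zero).neg.add
      (ContinuousOn.div (by fun_prop) (by fun_prop) fun x hx => pow_ne_zero 2 (ne_zero x hx))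

lemma mul_integral_besselInt_mul_cos (n : ℕ) (a : ℝ) {X R : ℝ} (hX : 0 < X) (hXR : X ≤ R) :
    (1 - a ^ 2) * ∫ x in X..R, besselInt n x * Real.cos (a * x) =
      (∫ x in X..R, besselRemainder n a x) + (besselBoundary n a X - besselBoundary n a R) := by
  have integrable := intervalIntegrable_besselRemainder n a hX hXR
  have integrable_cos := (intervalIntegrable_besselInt_mul_cos n a X R).const_mul (1 - a ^ 2)
  have integral_deriv := intervalIntegral.integral_eq_sub_of_hasDerivAt
    (fun x hx => hasDerivAt_besselBoundary n a (hX.trans_le (Set.uIcc_of_le hXR ▸ hx).1).ne')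
    (integrable.sub integrable_cos)
  rw [intervalIntegral.integral_sub integrable integrable_cos,
    intervalIntegral.integral_const_mul] at integral_deriv
  linarith

lemma abs_besselBoundary_le {n : ℕ} {x B : ℝ} (hJ : |besselInt n x| ≤ B)
    (hJ' : |besselIntDeriv n x| ≤ B) (a : ℝ) : |besselBoundary n a x| ≤ (1 + |a|) * B :=
  calc |besselBoundary n a x|
      ≤ |besselIntDeriv n x| * |Real.cos (a * x)| +
          |a| * (|besselInt n x| * |Real.sin (a * x)|) := by
        simp only [← abs_mul]
        exact abs_add_le _ _
    _ ≤ B * 1 + |a| * (B * 1) := by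
        have B_nonneg : 0 ≤ B := (abs_nonneg _).trans hJ
        gcongr
        · exact Real.abs_cos_le_one _
        · exact Real.abs_sin_le_one _
    _ = (1 + |a|) * B := by ring

lemma abs_besselRemainder_le {n : ℕ} {x X B : ℝ} (hX : 0 < X) (hx : X ≤ x)
    (hJ : |besselInt n x| ≤ B) (hJ' : |besselIntDeriv n x| ≤ B) (a : ℝ) :
    |besselRemainder n a x| ≤ (1 + n ^ 2 / X) * (B / x) := by
  have x_pos : 0 < x := hX.trans_le hx
  have B_nonneg : 0 ≤ B := (abs_nonneg _).trans hJ
  calc |besselRemainder n a x|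
      ≤ |besselIntDeriv n x| * |Real.cos (a * x)| / x +
          n ^ 2 * (|besselInt n x| * |Real.cos (a * x)|) / x ^ 2 := by
        refine (abs_add_le _ _).trans_eq ?_
        rw [abs_neg, abs_div, abs_div, abs_mul, abs_mul, abs_mul, abs_of_pos x_pos,
          abs_of_nonneg (sq_nonneg (n : ℝ)), abs_of_nonneg (sq_nonneg x)]
    _ ≤ B * 1 / x + n ^ 2 * (B * 1) / (x * X) := by
        rw [sq x]
        gcongr <;> exact Real.abs_cos_le_one _
    _ = (1 + n ^ 2 / X) * (B / x) := by field_simp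

lemma integral_one_div_sqrt_div_le {X R : ℝ} (hX : 0 < X) (hXR : X ≤ R) :
    IntervalIntegrable (fun x => 1 / √x / x) volume X R ∧
      ∫ x in X..R, 1 / √x / x ≤ 2 / √X := by
  have pos_of_mem : ∀ x ∈ Set.uIcc X R, 0 < x := fun x hx =>
    hX.trans_le (Set.uIcc_of_le hXR ▸ hx).1
  have integrable : IntervalIntegrable (fun x => 1 / √x / x) volume X R :=
    ContinuousOn.intervalIntegrable <| ((continuousOn_const.div (by fun_prop) fun x hx =>
      (Real.sqrt_pos.mpr (pos_of_mem x hx)).ne').div continuousOn_id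
        fun x hx => (pos_of_mem x hx).ne')
  have hasDerivAt : ∀ x ∈ Set.uIcc X R, HasDerivAt (fun x : ℝ => -(2 / √x)) (1 / √x / x) x := by
    intro x hx
    have x_pos := pos_of_mem x hx
    refine ((hasDerivAt_const x (2 : ℝ)).div (Real.hasDerivAt_sqrt x_pos.ne')
      (Real.sqrt_pos.mpr x_pos).ne').neg.congr_deriv ?_
    have sq_sqrt := Real.sq_sqrt x_pos.le
    field_simp
    linear_combination -sq_sqrt
  refine ⟨integrable, ?_⟩
  rw [intervalIntegral.integral_eq_sub_of_hasDerivAt hasDerivAt integrable]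
  linarith [show 0 ≤ 2 / √R by positivity]

lemma abs_integral_besselRemainder_le {n : ℕ} {D : ℝ} (hD : 0 ≤ D)
    (decay : ∀ x : ℝ, 0 < x → |besselInt n x| ≤ D / √x ∧ |besselIntDeriv n x| ≤ D / √x)
    (a : ℝ) {X R : ℝ} (hX : 0 < X) (hXR : X ≤ R) :
    |∫ x in X..R, besselRemainder n a x| ≤ D * (1 + n ^ 2 / X) * (2 / √X) := by
  obtain ⟨integrable, integral_le⟩ := integral_one_div_sqrt_div_le hX hXR
  calc |∫ x in X..R, besselRemainder n a x|
      ≤ ∫ x in X..R, D * (1 + n ^ 2 / X) * (1 / √x / x) := by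
        rw [← Real.norm_eq_abs]
        refine intervalIntegral.norm_integral_le_of_norm_le hXR (ae_of_all _ fun x hx => ?_)
          (integrable.const_mul _)
        obtain ⟨hJ, hJ'⟩ := decay x (hX.trans hx.1)
        refine (abs_besselRemainder_le hX hx.1.le hJ hJ' a).trans_eq ?_
        ring
    _ ≤ D * (1 + n ^ 2 / X) * (2 / √X) := by
        rw [intervalIntegral.integral_const_mul]
        gcongr

theorem abs_integral_besselInt_mul_cos_le {n : ℕ} {D : ℝ} (hD : 0 ≤ D)
    (decay : ∀ x : ℝ, 0 < x → |besselInt n x| ≤ D / √x ∧ |besselIntDeriv n x| ≤ D / √x)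
    (a : ℝ) {X R : ℝ} (hX : 0 < X) (hXR : X ≤ R) :
    |1 - a ^ 2| * |∫ x in X..R, besselInt n x * Real.cos (a * x)| ≤
      2 * D / √X * (2 + |a| + n ^ 2 / X) := by
  have boundary_le (x : ℝ) (hx : X ≤ x) : |besselBoundary n a x| ≤ (1 + |a|) * (D / √X) := by
    obtain ⟨hJ, hJ'⟩ := decay x (hX.trans_le hx)
    refine (abs_besselBoundary_le hJ hJ' a).trans ?_
    gcongr
  rw [← abs_mul, mul_integral_besselInt_mul_cos n a hX hXR]
  calc |(∫ x in X..R, besselRemainder n a x) + (besselBoundary n a X - besselBoundary n a R)|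
      ≤ |∫ x in X..R, besselRemainder n a x| + (|besselBoundary n a X| + |besselBoundary n a R|) :=
        (abs_add_le _ _).trans (by gcongr; exact abs_sub _ _)
    _ ≤ D * (1 + n ^ 2 / X) * (2 / √X) +
          ((1 + |a|) * (D / √X) + (1 + |a|) * (D / √X)) := by
        gcongr
        · exact abs_integral_besselRemainder_le hD decay a hX hXR
        · exact boundary_le X le_rfl
        · exact boundary_le R hXR
    _ = _ := by ring

lemma exists_tendsto_cosTransform (n : ℕ) {a : ℝ} (ha : a ^ 2 ≠ 1) :
    ∃ L : ℝ, Tendsto (fun R => cosTransform n R a) atTop (𝓝 L) := by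
  obtain ⟨D, hD, decay⟩ := exists_abs_besselInt_le_div_sqrt n
  have coeff_pos : 0 < |1 - a ^ 2| := abs_pos.mpr (sub_ne_zero.mpr ha.symm)
  have bound_tendsto : Tendsto (fun X : ℝ => 2 * D / √X * (2 + |a| + n ^ 2 / X)) atTop (𝓝 0) := by
    simpa only [zero_mul, id] using (tendsto_const_nhds.div_atTop Real.tendsto_sqrt_atTop).mul
      (tendsto_const_nhds.add (tendsto_const_nhds.div_atTop tendsto_id))
  refine cauchySeq_tendsto_of_complete (Metric.cauchySeq_iff'.mpr fun ε hε => ?_)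
  obtain ⟨N, bound_lt, hN⟩ := ((bound_tendsto.eventually_lt_const (mul_pos coeff_pos hε)).and
    (eventually_gt_atTop 0)).exists
  refine ⟨N, fun R hR => ?_⟩
  rw [Real.dist_eq, cosTransform, cosTransform, intervalIntegral.integral_interval_sub_left
    (intervalIntegrable_besselInt_mul_cos n a _ _) (intervalIntegrable_besselInt_mul_cos n a _ _)]
  exact lt_of_mul_lt_mul_left
    ((abs_integral_besselInt_mul_cos_le hD.le decay a hN hR).trans_lt bound_lt) coeff_pos.le

lemma one_div_sqrt_eq_rpow {x : ℝ} (hx : 0 ≤ x) : 1 / √x = x ^ (-(1 / 2) : ℝ) := by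
  rw [Real.rpow_neg hx, Real.sqrt_eq_rpow, one_div]

lemma intervalIntegrable_one_div_sqrt {R : ℝ} (hR : 0 ≤ R) :
    IntervalIntegrable (fun x : ℝ => 1 / √x) volume 0 R :=
  (intervalIntegral.intervalIntegrable_rpow' (by norm_num : (-1 : ℝ) < -(1 / 2))).congr
    fun _ hx => (one_div_sqrt_eq_rpow (Set.uIoc_of_le hR ▸ hx).1.le).symm

lemma integral_one_div_sqrt {R : ℝ} (hR : 0 ≤ R) : ∫ x in (0 : ℝ)..R, 1 / √x = 2 * √R := by
  rw [intervalIntegral.integral_congr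
    fun _ hx => one_div_sqrt_eq_rpow (Set.uIcc_of_le hR ▸ hx).1, integral_rpow (by norm_num),
    Real.sqrt_eq_rpow, Real.zero_rpow (by norm_num),
    show (-(1 / 2) + 1 : ℝ) = 1 / 2 by norm_num]
  ring

lemma abs_cosTransform_le_sqrt {n : ℕ} {D : ℝ}
    (decay : ∀ x : ℝ, 0 < x → |besselInt n x| ≤ D / √x) {R : ℝ} (hR : 0 ≤ R) (a : ℝ) :
    |cosTransform n R a| ≤ 2 * D * √R :=
  calc |cosTransform n R a| ≤ ∫ x in (0 : ℝ)..R, D * (1 / √x) := by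
        rw [← Real.norm_eq_abs, cosTransform]
        refine intervalIntegral.norm_integral_le_of_norm_le hR (ae_of_all _ fun x hx => ?_)
          ((intervalIntegrable_one_div_sqrt hR).const_mul D)
        rw [norm_mul, mul_one_div]
        exact (mul_le_of_le_one_right (abs_nonneg _) (Real.abs_cos_le_one _)).trans (decay x hx.1)
    _ = 2 * D * √R := by
        rw [intervalIntegral.integral_const_mul, integral_one_div_sqrt hR]
        ring

lemma abs_integral_inv_abs_one_sub_besselInt_mul_cos_le {n : ℕ} {D : ℝ} (hD : 0 ≤ D)
    (decay : ∀ x : ℝ, 0 < x → |besselInt n x| ≤ D / √x ∧ |besselIntDeriv n x| ≤ D / √x)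
    {a R : ℝ} (ha : 0 ≤ a) (ha₁ : a ≠ 1) (hR : 1 / |1 - a| ≤ R) :
    |∫ x in (1 / |1 - a|)..R, besselInt n x * Real.cos (a * x)| ≤
      2 * D * (2 + n ^ 2) / √|1 - a| := by
  have abs_sq_sub : |1 - a ^ 2| = |1 - a| * (1 + a) := by
    rw [show 1 - a ^ 2 = (1 - a) * (1 + a) by ring, abs_mul,
      abs_of_nonneg (add_nonneg zero_le_one ha)]
  have abs_sub_le : |1 - a| ≤ 1 + a := abs_le.mpr ⟨by linarith, by linarith⟩
  have u_pos : 0 < |1 - a| := abs_pos.mpr (sub_ne_zero.mpr ha₁.symm)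
  have by_parts := abs_integral_besselInt_mul_cos_le hD decay a (one_div_pos.mpr u_pos) hR
  rw [abs_sq_sub, abs_of_nonneg ha, Real.sqrt_div' _ u_pos.le, Real.sqrt_one] at by_parts
  generalize |1 - a| = u at *
  refine le_of_mul_le_mul_left (by_parts.trans ?_) (by positivity : 0 < u * (1 + a))
  calc 2 * D / (1 / √u) * (2 + a + n ^ 2 / (1 / u)) = 2 * D * √u * (2 + a + n ^ 2 * u) := by
        field_simp
    _ ≤ 2 * D * √u * ((1 + a) * (2 + n ^ 2)) := by
        gcongr
        nlinarith [mul_le_mul_of_nonneg_left abs_sub_le (sq_nonneg (n : ℝ))]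
    _ = u * (1 + a) * (2 * D * (2 + n ^ 2) / √u) := by
        nth_rw 2 [← Real.mul_self_sqrt u_pos.le]
        field_simp

theorem exists_abs_cosTransform_le (n : ℕ) : ∃ C : ℝ, 0 < C ∧
    ∀ R a : ℝ, 0 ≤ R → 0 ≤ a → a ≠ 1 → |cosTransform n R a| ≤ C / √|1 - a| := by
  obtain ⟨D, hD, decay⟩ := exists_abs_besselInt_le_div_sqrt n
  refine ⟨2 * D * (3 + n ^ 2), by positivity, fun R a hR ha ha₁ => ?_⟩
  -- The decay of `Jₙ` suffices up to `1 / |1 - a|`; beyond, the oscillation is used by parts.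
  have u_pos : 0 < |1 - a| := abs_pos.mpr (sub_ne_zero.mpr ha₁.symm)
  have initial_le (X : ℝ) (hX : 0 ≤ X) (hXu : X ≤ 1 / |1 - a|) :
      |cosTransform n X a| ≤ 2 * D * (1 / √|1 - a|) := by
    refine (abs_cosTransform_le_sqrt (fun x hx => (decay x hx).1) hX a).trans ?_
    have sqrt_one_div : √(1 / |1 - a|) = 1 / √|1 - a| := by
      rw [Real.sqrt_div' _ u_pos.le, Real.sqrt_one]
    rw [← sqrt_one_div]
    gcongr
  rcases le_total R (1 / |1 - a|) with hRu | hRu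
  · refine (initial_le R hR hRu).trans ?_
    rw [mul_one_div]
    refine div_le_div_of_nonneg_right ?_ (Real.sqrt_nonneg _)
    exact le_mul_of_one_le_right (by positivity) (by linarith [sq_nonneg (n : ℝ)])
  · rw [cosTransform, ← intervalIntegral.integral_add_adjacent_intervals
      (intervalIntegrable_besselInt_mul_cos n a 0 (1 / |1 - a|))
      (intervalIntegrable_besselInt_mul_cos n a (1 / |1 - a|) R)]
    refine (abs_add_le _ _).trans ((add_le_add (initial_le _ (by positivity) le_rfl)
      (abs_integral_inv_abs_one_sub_besselInt_mul_cos_le hD.le decay ha ha₁ hRu)).trans_eq ?_)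
    ring

end CosTransform

section Abel

variable {E : Type*} [NormedAddCommGroup E]

lemma exists_norm_le_of_continuous_of_tendsto_atTop {G : ℝ → E} {L : E} (hG : Continuous G)
    (hL : Tendsto G atTop (𝓝 L)) (a : ℝ) : ∃ M : ℝ, ∀ x : ℝ, a ≤ x → ‖G x‖ ≤ M := by
  obtain ⟨N, hN⟩ := eventually_atTop.mp (hL.norm.eventually_le_const (lt_add_one ‖L‖))
  obtain ⟨M, hM⟩ := (isCompact_Icc (a := a) (b := N)).exists_bound_of_continuousOn hG.continuousOn
  refine ⟨max M (‖L‖ + 1), fun x hx => ?_⟩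
  rcases le_total x N with hxN | hNx
  · exact (hM x ⟨hx, hxN⟩).trans (le_max_left _ _)
  · exact (hN x hNx).trans (le_max_right _ _)

variable [NormedSpace ℝ E]

lemma integrableOn_exp_neg_mul_smul {f : ℝ → E} {B ε : ℝ} (hf : Continuous f)
    (hB : ∀ x : ℝ, 0 ≤ x → ‖f x‖ ≤ B) (hε : 0 < ε) :
    IntegrableOn (fun x : ℝ => Real.exp (-(ε * x)) • f x) (Set.Ioi 0) := by
  have integrable : IntegrableOn (fun x : ℝ => Real.exp (-(ε * x)) * B) (Set.Ioi 0) := by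
    simpa only [neg_mul, IntegrableOn] using (exp_neg_integrableOn_Ioi 0 hε).mul_const B
  refine integrable.mono' (by fun_prop : Continuous _).aestronglyMeasurable
    ((ae_restrict_mem measurableSet_Ioi).mono fun x hx => ?_)
  rw [norm_smul, Real.norm_of_nonneg (Real.exp_nonneg _)]
  gcongr
  exact hB x (le_of_lt hx)

lemma tendsto_integral_exp_neg_smul_comp_inv_mul {G : ℝ → E} {L : E} [CompleteSpace E]
    (hG : Continuous G) (hL : Tendsto G atTop (𝓝 L)) :
    Tendsto (fun ε : ℝ => ∫ u in Set.Ioi (0 : ℝ), Real.exp (-u) • G (ε⁻¹ * u)) (𝓝[>] 0) (𝓝 L) := by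
  obtain ⟨M, hM⟩ := exists_norm_le_of_continuous_of_tendsto_atTop hG hL 0
  have integral_limit : ∫ u in Set.Ioi (0 : ℝ), Real.exp (-u) • L = L := by
    rw [integral_smul_const, integral_exp_neg_Ioi_zero, one_smul]
  rw [← integral_limit]
  refine tendsto_integral_filter_of_dominated_convergence (fun u => Real.exp (-u) * M)
    (Eventually.of_forall fun ε => (by fun_prop : Continuous _).aestronglyMeasurable) ?_
    ((integrableOn_exp_neg_Ioi 0).mul_const M)
    ((ae_restrict_mem measurableSet_Ioi).mono fun u hu =>
      (hL.comp (tendsto_inv_nhdsGT_zero.atTop_mul_const hu)).const_smul _)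
  filter_upwards [self_mem_nhdsWithin] with ε hε
  refine (ae_restrict_mem measurableSet_Ioi).mono fun u hu => ?_
  rw [norm_smul, Real.norm_of_nonneg (Real.exp_nonneg _)]
  gcongr
  exact hM _ (mul_nonneg (inv_nonneg.mpr (le_of_lt hε)) (le_of_lt hu))

variable [CompleteSpace E]

lemma integral_exp_neg_mul_smul_deriv {f G : ℝ → E} {B ε : ℝ} {L : E} (hf : Continuous f)
    (hB : ∀ x : ℝ, 0 ≤ x → ‖f x‖ ≤ B) (hG : ∀ x, HasDerivAt G (f x) x) (hG₀ : G 0 = 0)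
    (hL : Tendsto G atTop (𝓝 L)) (hε : 0 < ε) :
    ∫ x in Set.Ioi (0 : ℝ), Real.exp (-(ε * x)) • f x =
      ∫ u in Set.Ioi (0 : ℝ), Real.exp (-u) • G (ε⁻¹ * u) := by
  have continuous_G : Continuous G := continuous_iff_continuousAt.mpr fun x => (hG x).continuousAt
  obtain ⟨M, hM⟩ := exists_norm_le_of_continuous_of_tendsto_atTop continuous_G hL 0
  have integrable_f := integrableOn_exp_neg_mul_smul hf hB hε
  have integrable_G : IntegrableOn (fun x : ℝ => ε • (Real.exp (-(ε * x)) • G x)) (Set.Ioi 0) :=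
    (integrableOn_exp_neg_mul_smul continuous_G hM hε).smul ε
  have hasDerivAt (x : ℝ) : HasDerivAt (fun x => Real.exp (-(ε * x)) • G x)
      (Real.exp (-(ε * x)) • f x - ε • (Real.exp (-(ε * x)) • G x)) x := by
    refine ((((hasDerivAt_id' x).const_mul ε).neg.exp).smul (hG x)).congr_deriv ?_
    module
  have tendsto_zero : Tendsto (fun x => Real.exp (-(ε * x)) • G x) atTop (𝓝 ((0 : ℝ) • L)) :=
    (Real.tendsto_exp_neg_atTop_nhds_zero.comp (tendsto_id.const_mul_atTop hε)).smul hL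
  have by_parts := integral_Ioi_of_hasDerivAt_of_tendsto' (fun x _ => hasDerivAt x)
    (integrable_f.sub integrable_G) tendsto_zero
  rw [integral_sub integrable_f integrable_G, hG₀, zero_smul, smul_zero, sub_zero, sub_eq_zero]
    at by_parts
  have substitution := integral_comp_mul_left_Ioi (fun u => Real.exp (-u) • G (ε⁻¹ * u)) 0 hε
  simp only [mul_zero, inv_mul_cancel_left₀ hε.ne'] at substitution
  rw [by_parts, integral_smul, substitution, smul_inv_smul₀ hε.ne']

/-- **Abel's theorem** for improper integrals. -/
theorem tendsto_integral_exp_neg_mul_smul {f : ℝ → E} {B : ℝ} {L : E} (hf : Continuous f)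
    (hB : ∀ x : ℝ, 0 ≤ x → ‖f x‖ ≤ B)
    (hL : Tendsto (fun R : ℝ => ∫ x in (0 : ℝ)..R, f x) atTop (𝓝 L)) :
    Tendsto (fun ε : ℝ => ∫ x in Set.Ioi (0 : ℝ), Real.exp (-(ε * x)) • f x) (𝓝[>] 0) (𝓝 L) := by
  have hasDerivAt (x : ℝ) : HasDerivAt (fun R : ℝ => ∫ x in (0 : ℝ)..R, f x) (f x) x :=
    hf.integral_hasStrictDerivAt 0 x |>.hasDerivAt
  refine (tendsto_integral_exp_neg_smul_comp_inv_mul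
    (continuous_iff_continuousAt.mpr fun x => (hasDerivAt x).continuousAt) hL).congr' ?_
  filter_upwards [self_mem_nhdsWithin] with ε hε
  exact (integral_exp_neg_mul_smul_deriv hf hB hasDerivAt intervalIntegral.integral_same hL hε).symm

end Abel

section Laplace

open Complex

lemma integral_cexp_I_mul_intCast (c : ℤ) :
    ∫ θ in (-π)..π, cexp (I * c * θ) = if c = 0 then (2 * π : ℂ) else 0 := by
  split_ifs with hc
  · simp [hc, two_mul]
  · rw [integral_cexp_I_mul (Int.cast_ne_zero.mpr hc), mul_comm (π : ℂ), sin_int_mul_pi,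
      mul_zero, zero_div]

lemma hasSum_geometric_cexp {q : ℂ} (hq : ‖q‖ < 1) (c d : ℤ) (θ : ℝ) :
    HasSum (fun m : ℕ => q ^ m * cexp (I * (c + m * d : ℤ) * θ))
      (cexp (I * c * θ) * (1 - q * cexp (I * d * θ))⁻¹) := by
  have norm_lt_one : ‖q * cexp (I * d * θ)‖ < 1 := by
    rw [show I * d * (θ : ℂ) = ((d * θ : ℝ) : ℂ) * I by push_cast; ring, norm_mul,
      norm_exp_ofReal_mul_I, mul_one]
    exact hq
  refine ((hasSum_geometric_of_norm_lt_one norm_lt_one).mul_left _).congr_fun fun m => ?_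
  rw [mul_pow, ← Complex.exp_nat_mul, mul_left_comm, ← Complex.exp_add]
  push_cast
  ring_nf

lemma hasSum_integral_geometric_cexp {q : ℂ} (hq : ‖q‖ < 1) (c d : ℤ) :
    HasSum (fun m : ℕ => q ^ m * if c + m * d = 0 then (2 * π : ℂ) else 0)
      (∫ θ in (-π)..π, cexp (I * c * θ) * (1 - q * cexp (I * d * θ))⁻¹) := by
  have hasSum := intervalIntegral.hasSum_integral_of_dominated_convergence (μ := volume)
    (a := -π) (b := π) (F := fun (m : ℕ) (θ : ℝ) => q ^ m * cexp (I * (c + m * d : ℤ) * θ))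
    (fun m _ => ‖q‖ ^ m) (fun m => (by fun_prop : Continuous _).aestronglyMeasurable)
    (fun m => ae_of_all _ fun θ _ => ?_)
    (ae_of_all _ fun θ _ => summable_geometric_of_lt_one (norm_nonneg _) hq)
    intervalIntegrable_const (ae_of_all _ fun θ _ => hasSum_geometric_cexp hq c d θ)
  · simpa only [intervalIntegral.integral_const_mul, integral_cexp_I_mul_intCast] using hasSum
  · rw [norm_mul, norm_pow, show I * (c + m * d : ℤ) * (θ : ℂ) = (((c + m * d : ℤ) * θ : ℝ) : ℂ) * I
      by push_cast; ring, norm_exp_ofReal_mul_I, mul_one]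

lemma integral_geometric_cexp_pos {q : ℂ} (hq : ‖q‖ < 1) (n : ℕ) :
    ∫ θ in (-π)..π, cexp (-(I * n * θ)) * (1 - q * cexp (I * θ))⁻¹ = 2 * π * q ^ n := by
  have hasSum := hasSum_integral_geometric_cexp hq (-n) 1
  have single := hasSum_single (f := fun m : ℕ => q ^ m * if -(n : ℤ) + m * 1 = 0
    then (2 * π : ℂ) else 0) n fun m hm => by rw [if_neg (by omega), mul_zero]
  rw [if_pos (by ring)] at single
  rw [mul_comm (2 * π : ℂ), ← hasSum.unique single]
  refine intervalIntegral.integral_congr fun θ _ => ?_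
  push_cast
  ring_nf

lemma integral_geometric_cexp_neg {q : ℂ} (hq : ‖q‖ < 1) (n : ℕ) :
    ∫ θ in (-π)..π, cexp (-(I * n * θ)) * (cexp (-(I * θ)) * (1 - q * cexp (-(I * θ)))⁻¹) = 0 := by
  have hasSum := hasSum_integral_geometric_cexp hq (-(n + 1)) (-1)
  have terms_eq_zero : (fun m : ℕ => q ^ m * if -((n : ℤ) + 1) + m * -1 = 0
      then (2 * π : ℂ) else 0) = fun _ => 0 :=
    funext fun m => by rw [if_neg (by omega), mul_zero]
  rw [terms_eq_zero] at hasSum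
  rw [← hasSum.unique hasSum_zero]
  refine intervalIntegral.integral_congr fun θ _ => ?_
  simp only [← mul_assoc, ← Complex.exp_add]
  push_cast
  ring_nf

lemma one_sub_mul_cexp_ne_zero {q w : ℂ} (hq : ‖q‖ < 1) (hw : w.re = 0) :
    1 - q * cexp w ≠ 0 := by
  refine sub_ne_zero.mpr fun h => hq.ne ?_
  rw [← norm_one (α := ℂ), h, norm_mul, Complex.norm_exp, hw, Real.exp_zero, mul_one]

lemma ne_zero_of_sq_eq_of_norm_sub_lt {p s : ℂ} (hs : s ^ 2 = 1 + p ^ 2) (hsp : ‖s - p‖ < 1) :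
    s ≠ 0 := by
  rintro rfl
  have norm_sq : ‖p‖ ^ 2 = 1 := by
    rw [← norm_pow, show p ^ 2 = -1 by linear_combination -hs, norm_neg, norm_one]
  rw [zero_sub, norm_neg] at hsp
  exact (pow_lt_one₀ (norm_nonneg p) hsp two_ne_zero).ne norm_sq

lemma inv_sub_I_mul_sin_eq {p s : ℂ} (hs : s ^ 2 = 1 + p ^ 2) (hsp : ‖s - p‖ < 1) (θ : ℝ) :
    (p - I * sin θ)⁻¹ = s⁻¹ * ((1 - (s - p) * cexp (I * θ))⁻¹ +
      (p - s) * (cexp (-(I * θ)) * (1 - (p - s) * cexp (-(I * θ)))⁻¹)) := by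
  have I_mul_sin : I * sin θ = (cexp (I * θ) - cexp (-(I * θ))) / 2 := by
    rw [sin, show (-(θ : ℂ)) * I = -(I * θ) by ring, mul_comm (θ : ℂ) I]
    linear_combination -(cexp (I * θ) - cexp (-(I * θ))) / 2 * I_sq
  have pos_ne := one_sub_mul_cexp_ne_zero hsp (w := I * θ) (by simp)
  have neg_ne := one_sub_mul_cexp_ne_zero (norm_sub_rev s p ▸ hsp) (w := -(I * θ)) (by simp)
  have exp_mul_exp : cexp (I * θ) * cexp (-(I * θ)) = 1 := by
    rw [← Complex.exp_add, add_neg_cancel, Complex.exp_zero]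
  have factor : 2 * (s - p) * (p - I * sin θ) =
      (1 - (s - p) * cexp (I * θ)) * (1 - (p - s) * cexp (-(I * θ))) := by
    rw [I_mul_sin]
    linear_combination (s - p) ^ 2 * exp_mul_exp + hs
  have sub_ne : s - p ≠ 0 := left_ne_zero_of_mul_eq_one
    (by linear_combination hs : (s - p) * (s + p) = 1)
  have eq_div : p - I * sin θ = (1 - (s - p) * cexp (I * θ)) *
      (1 - (p - s) * cexp (-(I * θ))) / (2 * (s - p)) := by
    rw [eq_div_iff (mul_ne_zero two_ne_zero sub_ne), ← factor, mul_comm]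
  have s_ne := ne_zero_of_sq_eq_of_norm_sub_lt hs hsp
  rw [eq_div]
  field_simp
  linear_combination hs - (s - p) ^ 2 * exp_mul_exp

lemma integral_cexp_mul_inv_sub_I_mul_sin (n : ℕ) {p s : ℂ} (hs : s ^ 2 = 1 + p ^ 2)
    (hsp : ‖s - p‖ < 1) :
    ∫ θ in (-π)..π, cexp (-(I * n * θ)) * (p - I * sin θ)⁻¹ = 2 * π * ((s - p) ^ n / s) := by
  have hps : ‖p - s‖ < 1 := norm_sub_rev s p ▸ hsp
  have continuous_pos : Continuous fun θ : ℝ =>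
      cexp (-(I * n * θ)) * (1 - (s - p) * cexp (I * θ))⁻¹ :=
    Continuous.mul (by fun_prop)
      (Continuous.inv₀ (by fun_prop) fun θ => one_sub_mul_cexp_ne_zero hsp (by simp))
  have continuous_neg : Continuous fun θ : ℝ =>
      cexp (-(I * n * θ)) * (cexp (-(I * θ)) * (1 - (p - s) * cexp (-(I * θ)))⁻¹) :=
    Continuous.mul (by fun_prop) (Continuous.mul (by fun_prop)
      (Continuous.inv₀ (by fun_prop) fun θ => one_sub_mul_cexp_ne_zero hps (by simp)))
  calc ∫ θ in (-π)..π, cexp (-(I * n * θ)) * (p - I * sin θ)⁻¹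
      = ∫ θ in (-π)..π, s⁻¹ * (cexp (-(I * n * θ)) * (1 - (s - p) * cexp (I * θ))⁻¹ +
          (p - s) *
            (cexp (-(I * n * θ)) * (cexp (-(I * θ)) * (1 - (p - s) * cexp (-(I * θ)))⁻¹))) := by
        refine intervalIntegral.integral_congr fun θ _ => ?_
        simp only [inv_sub_I_mul_sin_eq hs hsp]
        ring
    _ = s⁻¹ * (2 * π * (s - p) ^ n + (p - s) * 0) := by
        rw [intervalIntegral.integral_const_mul, intervalIntegral.integral_add
          (continuous_pos.intervalIntegrable _ _)
          ((continuous_neg.intervalIntegrable _ _).const_mul (p - s)),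
          intervalIntegral.integral_const_mul, integral_geometric_cexp_pos hsp,
          integral_geometric_cexp_neg hps]
    _ = 2 * π * ((s - p) ^ n / s) := by ring

lemma norm_cexp_neg_mul_ofReal (p : ℂ) (x : ℝ) :
    ‖cexp (-(p * x))‖ = Real.exp (-(p.re * x)) := by
  rw [Complex.norm_exp, neg_re, re_mul_ofReal]

lemma norm_cexp_bessel_phase (n : ℕ) (x θ : ℝ) : ‖cexp (I * (x * sin θ - n * θ))‖ = 1 := by
  rw [show I * (x * sin θ - n * θ) = ((x * Real.sin θ - n * θ : ℝ) : ℂ) * I by push_cast; ring,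
    norm_exp_ofReal_mul_I]

lemma laplace_bessel_phase (n : ℕ) {p : ℂ} (hp : 0 < p.re) (θ : ℝ) :
    ∫ x in Set.Ioi (0 : ℝ), cexp (-(p * x)) * cexp (I * (x * sin θ - n * θ)) =
      cexp (-(I * n * θ)) * (p - I * sin θ)⁻¹ := by
  have re_neg : (-(p - I * sin θ)).re < 0 := by
    rw [← ofReal_sin]
    simpa [-ofReal_sin] using hp
  have integral_exp := integral_exp_mul_complex_Ioi re_neg 0
  rw [ofReal_zero, mul_zero, Complex.exp_zero, neg_div_neg_eq, one_div] at integral_exp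
  rw [← integral_exp, ← integral_const_mul]
  refine integral_congr_ae (ae_of_all _ fun x => ?_)
  simp only [← Complex.exp_add]
  ring_nf

theorem laplace_besselInt (n : ℕ) {p s : ℂ} (hp : 0 < p.re) (hs : s ^ 2 = 1 + p ^ 2)
    (hsp : ‖s - p‖ < 1) :
    ∫ x in Set.Ioi (0 : ℝ), cexp (-(p * x)) * besselInt n x = (s - p) ^ n / s := by
  have pi_ne_zero : (π : ℂ) ≠ 0 := ofReal_ne_zero.mpr Real.pi_ne_zero
  have integrable_exp : IntegrableOn (fun x : ℝ => Real.exp (-(p.re * x))) (Set.Ioi 0) := by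
    simpa only [neg_mul] using exp_neg_integrableOn_Ioi 0 hp
  have integrable : Integrable (Function.uncurry fun (θ x : ℝ) =>
      cexp (-(p * x)) * cexp (I * (x * sin θ - n * θ)))
      ((volume.restrict (Set.uIoc (-π) π)).prod (volume.restrict (Set.Ioi 0))) := by
    have integrable_one : IntervalIntegrable (fun _ => (1 : ℝ)) volume (-π) π :=
      intervalIntegrable_const
    refine (integrable_one.def'.mul_prod integrable_exp).mono'
      (by fun_prop : Continuous _).aestronglyMeasurable (ae_of_all _ fun z => le_of_eq ?_)
    rw [Function.uncurry_def, norm_mul, norm_cexp_neg_mul_ofReal, norm_cexp_bessel_phase, mul_one,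
      one_mul]
  calc ∫ x in Set.Ioi (0 : ℝ), cexp (-(p * x)) * besselInt n x
      = ∫ x in Set.Ioi (0 : ℝ), 1 / (2 * π) *
          ∫ θ in (-π)..π, cexp (-(p * x)) * cexp (I * (x * sin θ - n * θ)) := by
        refine integral_congr_ae (ae_of_all _ fun x => ?_)
        simp only [ofReal_besselInt, intervalIntegral.integral_const_mul]
        ring
    _ = 1 / (2 * π) * ∫ θ in (-π)..π, cexp (-(I * n * θ)) * (p - I * sin θ)⁻¹ := by
        rw [integral_const_mul, ← intervalIntegral_integral_swap integrable]
        simp only [laplace_bessel_phase n hp]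
    _ = (s - p) ^ n / s := by
        rw [integral_cexp_mul_inv_sub_I_mul_sin n hs hsp]
        field_simp

lemma integral_exp_neg_mul_besselInt_mul_cos (n : ℕ) {p : ℂ} (hp : 0 < p.re) :
    ∫ x in Set.Ioi (0 : ℝ), Real.exp (-(p.re * x)) * (besselInt n x * Real.cos (p.im * x)) =
      (∫ x in Set.Ioi (0 : ℝ), cexp (-(p * x)) * besselInt n x).re := by
  have integrable_exp : IntegrableOn (fun x : ℝ => Real.exp (-(p.re * x))) (Set.Ioi 0) := by
    simpa only [neg_mul] using exp_neg_integrableOn_Ioi 0 hp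
  have integrable : IntegrableOn (fun x : ℝ => cexp (-(p * x)) * besselInt n x) (Set.Ioi 0) := by
    refine integrable_exp.mono' (by fun_prop : Continuous _).aestronglyMeasurable
      (ae_of_all _ fun x => ?_)
    rw [norm_mul, norm_cexp_neg_mul_ofReal, norm_real]
    exact mul_le_of_le_one_right (Real.exp_nonneg _) (abs_besselInt_le_one n x)
  rw [← reCLM_apply (∫ x in _, _), ← reCLM.integral_comp_comm integrable]
  refine integral_congr_ae (ae_of_all _ fun x => ?_)
  simp only [reCLM_apply, re_mul_ofReal, Complex.exp_re, neg_re, neg_im, im_mul_ofReal,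
    Real.cos_neg]
  ring

end Laplace

section CosTransformLimit

open Complex

lemma sqrt_sq_eq (ζ : ℂ) : Complex.sqrt ζ ^ 2 = ζ := by
  simpa only [Complex.sqrt, Nat.cast_ofNat] using cpow_nat_inv_pow ζ two_ne_zero

lemma continuousOn_complex_sqrt : ContinuousOn Complex.sqrt {ζ : ℂ | 0 ≤ ζ.im} := by
  have continuous : Continuous fun ζ : ℂ =>
      ((√((‖ζ‖ + ζ.re) / 2) : ℝ) : ℂ) + (√((‖ζ‖ - ζ.re) / 2) : ℝ) * I := by
    have := continuous_re
    fun_prop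
  refine continuous.continuousOn.congr fun ζ hζ => ?_
  rw [sqrt_eq_real_add_ite, if_pos (show 0 ≤ ζ.im from hζ), one_mul]

lemma norm_sub_lt_one_of_sq_eq {s p : ℂ} (hs : s ^ 2 = 1 + p ^ 2)
    (hsp : 0 < s.re * p.re + s.im * p.im) : ‖s - p‖ < 1 := by
  have norm_mul_norm : ‖s - p‖ * ‖s + p‖ = 1 := by
    rw [← norm_mul, show (s - p) * (s + p) = 1 by linear_combination hs, norm_one]
  have norm_sq_lt : ‖s - p‖ ^ 2 < ‖s + p‖ ^ 2 := by
    rw [Complex.sq_norm, Complex.sq_norm, normSq_apply, normSq_apply, sub_re, sub_im, add_re,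
      add_im]
    nlinarith
  have norm_lt : ‖s - p‖ < ‖s + p‖ := lt_of_pow_lt_pow_left₀ 2 (norm_nonneg _) norm_sq_lt
  by_contra! one_le
  nlinarith

lemma norm_sqrt_one_add_sq_sub_lt_one {p : ℂ} (hre : 0 < p.re) (him : 0 < p.im) :
    ‖Complex.sqrt (1 + p ^ 2) - p‖ < 1 := by
  have im_pos : 0 < (1 + p ^ 2).im := by
    rw [add_im, one_im, sq, mul_im]
    nlinarith [mul_pos hre him]
  have sqrt_re_pos : 0 < (Complex.sqrt (1 + p ^ 2)).re := by
    rw [Complex.sqrt, cpow_inv_two_re]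
    have := neg_lt_of_abs_lt (abs_re_lt_norm.mpr im_pos.ne')
    exact Real.sqrt_pos.mpr (by linarith)
  have sqrt_im_nonneg : 0 ≤ (Complex.sqrt (1 + p ^ 2)).im := by
    rw [Complex.sqrt, cpow_inv_two_im_eq_sqrt im_pos.le]
    exact Real.sqrt_nonneg _
  exact norm_sub_lt_one_of_sq_eq (sqrt_sq_eq _) (by positivity)

/-- The Laplace transform of `besselInt n`, continued to the closed first quadrant. -/
def besselLaplace (n : ℕ) (p : ℂ) : ℂ :=
  (Complex.sqrt (1 + p ^ 2) - p) ^ n / Complex.sqrt (1 + p ^ 2)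

lemma integral_exp_neg_mul_besselInt_mul_cos_eq_re (n : ℕ) {p : ℂ} (hre : 0 < p.re)
    (him : 0 < p.im) :
    ∫ x in Set.Ioi (0 : ℝ), Real.exp (-(p.re * x)) * (besselInt n x * Real.cos (p.im * x)) =
      (besselLaplace n p).re := by
  rw [integral_exp_neg_mul_besselInt_mul_cos n hre, laplace_besselInt n hre (sqrt_sq_eq _)
    (norm_sqrt_one_add_sq_sub_lt_one hre him), besselLaplace]

lemma continuousWithinAt_besselLaplace (n : ℕ) {p : ℂ} (hre : 0 ≤ p.re) (him : 0 ≤ p.im)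
    (hp : 1 + p ^ 2 ≠ 0) :
    ContinuousWithinAt (besselLaplace n) {p | 0 ≤ p.re ∧ 0 ≤ p.im} p := by
  have sqrt_ne_zero : Complex.sqrt (1 + p ^ 2) ≠ 0 := fun h =>
    hp (by rw [← sqrt_sq_eq (1 + p ^ 2), h, zero_pow two_ne_zero])
  have mapsTo : Set.MapsTo (fun p : ℂ => 1 + p ^ 2) {p | 0 ≤ p.re ∧ 0 ≤ p.im} {ζ | 0 ≤ ζ.im} := by
    rintro p ⟨hre, him⟩
    rw [Set.mem_ofPred_eq, add_im, one_im, sq, mul_im]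
    nlinarith [mul_nonneg hre him]
  have continuous_sqrt : ContinuousWithinAt (fun p : ℂ => Complex.sqrt (1 + p ^ 2))
      {p | 0 ≤ p.re ∧ 0 ≤ p.im} p :=
    ContinuousWithinAt.comp (f := fun p : ℂ => 1 + p ^ 2)
      (continuousOn_complex_sqrt _ (mapsTo ⟨hre, him⟩))
      (by fun_prop : Continuous fun p : ℂ => 1 + p ^ 2).continuousWithinAt mapsTo
  exact ((continuous_sqrt.sub continuousWithinAt_id).pow n).div continuous_sqrt sqrt_ne_zero

lemma tendsto_cosTransform_besselLaplace (n : ℕ) {a : ℝ} (ha : 0 < a) (ha₁ : a ^ 2 ≠ 1) :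
    Tendsto (fun R => cosTransform n R a) atTop (𝓝 (besselLaplace n (a * I)).re) := by
  obtain ⟨L, hL⟩ := exists_tendsto_cosTransform n ha₁
  have bounded (x : ℝ) : ‖besselInt n x * Real.cos (a * x)‖ ≤ 1 := by
    rw [norm_mul]
    exact mul_le_one₀ (abs_besselInt_le_one n x) (norm_nonneg _) (Real.abs_cos_le_one _)
  have abel := tendsto_integral_exp_neg_mul_smul (by fun_prop) (fun x _ => bounded x) hL
  have path_tendsto : Tendsto (fun ε : ℝ => (ε + a * I : ℂ)) (𝓝[>] 0)
      (𝓝[{p | 0 ≤ p.re ∧ 0 ≤ p.im}] (a * I)) := by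
    refine tendsto_nhdsWithin_iff.mpr ⟨?_, ?_⟩
    · have continuous : Continuous fun ε : ℝ => (ε + a * I : ℂ) := by fun_prop
      simpa using (continuous.tendsto 0).mono_left nhdsWithin_le_nhds
    · filter_upwards [self_mem_nhdsWithin] with ε hε
      simpa using ⟨le_of_lt hε, ha.le⟩
  have ne_zero : 1 + (a * I : ℂ) ^ 2 ≠ 0 := by
    rw [mul_pow, I_sq, mul_neg_one, ← sub_eq_add_neg, sub_ne_zero]
    exact_mod_cast ha₁.symm
  have laplace_tendsto := (continuous_re.tendsto _).comp
    ((continuousWithinAt_besselLaplace n (by simp) (by simpa using ha.le) ne_zero).tendsto.comp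
      path_tendsto)
  rwa [tendsto_nhds_unique abel (laplace_tendsto.congr' ?_)] at hL
  filter_upwards [self_mem_nhdsWithin] with ε hε
  have formula := integral_exp_neg_mul_besselInt_mul_cos_eq_re n (p := ε + a * I)
    (by simpa using hε) (by simpa using ha)
  simpa using formula.symm

theorem tendsto_cosTransform_of_lt_one (n : ℕ) {a : ℝ} (ha : 0 < a) (ha₁ : a < 1) :
    Tendsto (fun R => cosTransform n R a) atTop
      (𝓝 (Real.cos (n * Real.arcsin a) / √(1 - a ^ 2))) := by
  have sub_pos : 0 < 1 - a ^ 2 := by nlinarith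
  have sqrt_eq : Complex.sqrt (1 + (a * I) ^ 2) = √(1 - a ^ 2) := by
    rw [show (1 + (a * I) ^ 2 : ℂ) = ((1 - a ^ 2 : ℝ) : ℂ) by
      push_cast; linear_combination (a : ℂ) ^ 2 * I_sq]
    exact Complex.sqrt_of_nonneg (by exact_mod_cast sub_pos.le)
  have sub_eq_exp : (√(1 - a ^ 2) : ℂ) - a * I = cexp ((-Real.arcsin a : ℝ) * I) := by
    rw [exp_mul_I, ← ofReal_cos, ← ofReal_sin, Real.cos_neg, Real.sin_neg, Real.cos_arcsin,
      Real.sin_arcsin (by linarith) ha₁.le, ofReal_neg]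
    ring
  convert tendsto_cosTransform_besselLaplace n ha (by nlinarith) using 2
  rw [besselLaplace, sqrt_eq, sub_eq_exp, ← Complex.exp_nat_mul, div_ofReal_re, ← mul_assoc,
    ← ofReal_natCast, ← ofReal_mul, exp_ofReal_mul_I_re, mul_neg, Real.cos_neg]

theorem tendsto_cosTransform_of_one_lt (n : ℕ) {a : ℝ} (ha : 1 < a) :
    Tendsto (fun R => cosTransform n R a) atTop
      (𝓝 (Real.cos ((n + 1) * (π / 2)) / (√(a ^ 2 - 1) * (a + √(a ^ 2 - 1)) ^ n))) := by
  have sub_pos : 0 < a ^ 2 - 1 := by nlinarith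
  have sqrt_eq : Complex.sqrt (1 + (a * I) ^ 2) = I * √(a ^ 2 - 1) := by
    rw [show (1 + (a * I) ^ 2 : ℂ) = -((a ^ 2 - 1 : ℝ) : ℂ) by
      push_cast; linear_combination (a : ℂ) ^ 2 * I_sq,
      Complex.sqrt_neg_of_nonneg (by exact_mod_cast sub_pos.le),
      Complex.sqrt_of_nonneg (by exact_mod_cast sub_pos.le), ofReal_re]
  have sqrt_pos := Real.sqrt_pos.mpr sub_pos
  have sq_sqrt := Real.sq_sqrt sub_pos.le
  convert tendsto_cosTransform_besselLaplace n (zero_lt_one.trans ha) (by nlinarith) using 2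
  rw [besselLaplace, sqrt_eq]
  generalize √(a ^ 2 - 1) = τ at *
  have sum_ne : (a + τ : ℂ) ≠ 0 := by exact_mod_cast (by positivity : a + τ ≠ 0)
  have exp_eq : cexp ((-(π / 2) : ℝ) * I) = -I := by
    rw [exp_mul_I, ← ofReal_cos, ← ofReal_sin, Real.cos_neg, Real.sin_neg, Real.cos_pi_div_two,
      Real.sin_pi_div_two]
    simp
  have sub_eq : I * τ - a * I = -I / (a + τ) := by
    rw [eq_div_iff sum_ne]
    linear_combination I * (by exact_mod_cast sq_sqrt : (τ : ℂ) ^ 2 = a ^ 2 - 1)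
  have quotient_eq : (I * τ - a * I) ^ n / (I * τ) =
      cexp (((n + 1) * -(π / 2) : ℝ) * I) / (τ * (a + τ) ^ n : ℝ) := by
    rw [sub_eq, show (((n + 1) * -(π / 2) : ℝ) * I : ℂ) = (n + 1 : ℕ) * ((-(π / 2) : ℝ) * I) by
      push_cast; ring, Complex.exp_nat_mul, exp_eq, div_pow, pow_succ]
    push_cast
    field_simp
    rw [I_sq]
    ring
  rw [quotient_eq, div_ofReal_re, exp_ofReal_mul_I_re, mul_neg, Real.cos_neg]

end CosTransformLimit

section SquareRootSingularities

lemma one_div_sqrt_mul_sqrt_le {u v : ℝ} (hu : 0 < u) (hv : 0 < v) :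
    1 / (√u * √v) ≤ (1 / √u + 1 / √v) / √(u + v) := by
  have hu' := Real.sqrt_pos.mpr hu
  have hv' := Real.sqrt_pos.mpr hv
  have sqrt_add_le : √(u + v) ≤ √u + √v := by
    rw [Real.sqrt_le_left (by positivity)]
    nlinarith [Real.sq_sqrt hu.le, Real.sq_sqrt hv.le]
  have add_eq : 1 / √u + 1 / √v = (√u + √v) / (√u * √v) := by
    field_simp
    ring
  rw [le_div_iff₀ (by positivity), add_eq, one_div_mul_eq_div]
  gcongr

lemma sqrt_sq_sub_one {y : ℝ} (hy : 1 ≤ y) : √(y ^ 2 - 1) = √(y - 1) * √(y + 1) := by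
  rw [← Real.sqrt_mul (sub_nonneg.mpr hy)]
  ring_nf

lemma intervalIntegrable_inv_sqrt_sq_sub_one {b : ℝ} (hb : 1 ≤ b) :
    IntervalIntegrable (fun y => (√(y ^ 2 - 1))⁻¹) volume 1 b := by
  rw [intervalIntegrable_iff_integrableOn_Ioc_of_le hb]
  exact intervalIntegral.integrableOn_deriv_of_nonneg
    (Real.continuousOn_arcosh.mono Set.Icc_subset_Ici_self)
    (fun x hx => Real.hasDerivAt_arcosh hx.1) (fun x _ => by positivity)

lemma integral_inv_sqrt_sq_sub_one {b : ℝ} (hb : 1 ≤ b) :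
    ∫ y in 1..b, (√(y ^ 2 - 1))⁻¹ = Real.arcosh b := by
  rw [intervalIntegral.integral_eq_sub_of_hasDerivAt_of_le hb
    (Real.continuousOn_arcosh.mono Set.Icc_subset_Ici_self)
    (fun x hx => Real.hasDerivAt_arcosh hx.1) (intervalIntegrable_inv_sqrt_sq_sub_one hb),
    Real.arcosh_zero, sub_zero]

lemma intervalIntegrable_one_div_sqrt_sub_left {a b : ℝ} (hab : a ≤ b) :
    IntervalIntegrable (fun y => 1 / √(b - y)) volume a b := by
  simpa using ((intervalIntegrable_one_div_sqrt (sub_nonneg.mpr hab)).comp_sub_left b).symm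

lemma intervalIntegrable_one_div_sqrt_sub_right {a b : ℝ} (hab : a ≤ b) :
    IntervalIntegrable (fun y => 1 / √(y - a)) volume a b := by
  simpa using (intervalIntegrable_one_div_sqrt (sub_nonneg.mpr hab)).comp_sub_right a

lemma integral_one_div_sqrt_sub_left {a b : ℝ} (hab : a ≤ b) :
    ∫ y in a..b, 1 / √(b - y) = 2 * √(b - a) := by
  rw [intervalIntegral.integral_comp_sub_left (fun x => 1 / √x) b, sub_self,
    integral_one_div_sqrt (sub_nonneg.mpr hab)]

lemma integral_one_div_sqrt_sub_right {a b : ℝ} (hab : a ≤ b) :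
    ∫ y in a..b, 1 / √(y - a) = 2 * √(b - a) := by
  rw [intervalIntegral.integral_comp_sub_right (fun x => 1 / √x) a, sub_self,
    integral_one_div_sqrt (sub_nonneg.mpr hab)]

/-- A majorant of `√b / (√(b - y) √(y² - 1))` on `(1, b)`, obtained by splitting the products
`√(b - y) √(y ∓ 1)` additively. Its integral grows only like `log b` and stays bounded as
`b → 1`. -/
def leftMajorant (b y : ℝ) : ℝ :=
  √(b / (b - 1)) * ((1 / √(b - y) + 1 / √(y - 1)) / √(b + 1) + (√(y ^ 2 - 1))⁻¹)

lemma le_leftMajorant {b y : ℝ} (hy : 1 < y) (hyb : y < b) :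
    √b / (√(b - y) * √(y ^ 2 - 1)) ≤ leftMajorant b y := by
  have hu : 0 < b - y := by linarith
  have hv : 0 < y - 1 := by linarith
  have : 0 < √(b - y) := Real.sqrt_pos.mpr hu
  have : 0 < √(y - 1) := Real.sqrt_pos.mpr hv
  have : 0 < √(y + 1) := Real.sqrt_pos.mpr (by linarith)
  have : 0 < √(b - 1) := Real.sqrt_pos.mpr (by linarith)
  have split_sub : 1 / (√(b - y) * √(y - 1)) ≤ (1 / √(b - y) + 1 / √(y - 1)) / √(b - 1) := by
    simpa using one_div_sqrt_mul_sqrt_le hu hv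
  have split_add : 1 / (√(b - y) * √(y + 1)) ≤ (1 / √(b - y) + 1 / √(y - 1)) / √(b + 1) :=
    calc 1 / (√(b - y) * √(y + 1)) ≤ (1 / √(b - y) + 1 / √(y + 1)) / √(b + 1) := by
          convert one_div_sqrt_mul_sqrt_le hu (by linarith : 0 < y + 1) using 3
          ring
      _ ≤ _ := by
          gcongr
          linarith
  rw [leftMajorant, sqrt_sq_sub_one hy.le, Real.sqrt_div (by linarith)]
  calc √b / (√(b - y) * (√(y - 1) * √(y + 1)))
      = √b / √(y + 1) * (1 / (√(b - y) * √(y - 1))) := by field_simp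
    _ ≤ √b / √(y + 1) * ((1 / √(b - y) + 1 / √(y - 1)) / √(b - 1)) := by gcongr
    _ = √b / √(b - 1) * (1 / (√(b - y) * √(y + 1)) + (√(y - 1) * √(y + 1))⁻¹) := by field_simp
    _ ≤ √b / √(b - 1) * ((1 / √(b - y) + 1 / √(y - 1)) / √(b + 1) +
          (√(y - 1) * √(y + 1))⁻¹) := by gcongr

lemma leftMajorant_nonneg (b y : ℝ) : 0 ≤ leftMajorant b y := by
  unfold leftMajorant
  positivity

lemma intervalIntegrable_leftMajorant {b : ℝ} (hb : 1 ≤ b) :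
    IntervalIntegrable (leftMajorant b) volume 1 b :=
  ((((intervalIntegrable_one_div_sqrt_sub_left hb).add
    (intervalIntegrable_one_div_sqrt_sub_right hb)).div_const _).add
      (intervalIntegrable_inv_sqrt_sq_sub_one hb)).const_mul _

lemma integral_leftMajorant {b : ℝ} (hb : 1 ≤ b) :
    ∫ y in 1..b, leftMajorant b y =
      √(b / (b - 1)) * (4 * √(b - 1) / √(b + 1) + Real.arcosh b) := by
  have hl := intervalIntegrable_one_div_sqrt_sub_left hb
  have hr := intervalIntegrable_one_div_sqrt_sub_right hb
  simp only [leftMajorant]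
  rw [intervalIntegral.integral_const_mul, intervalIntegral.integral_add
    ((hl.add hr).div_const _) (intervalIntegrable_inv_sqrt_sq_sub_one hb),
    intervalIntegral.integral_div, intervalIntegral.integral_add hl hr,
    integral_one_div_sqrt_sub_left hb, integral_one_div_sqrt_sub_right hb,
    integral_inv_sqrt_sq_sub_one hb]
  ring

lemma arcosh_le_sqrt_sq_sub_one {b : ℝ} (hb : 1 ≤ b) : Real.arcosh b ≤ √(b ^ 2 - 1) := by
  rw [← Real.sinh_arcosh hb]
  exact Real.self_le_sinh_iff.mpr (Real.arcosh_nonneg hb)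

lemma arcosh_le_one_add_log {b : ℝ} (hb : 1 ≤ b) : Real.arcosh b ≤ 1 + Real.log b := by
  have sqrt_le : √(b ^ 2 - 1) ≤ b := by
    rw [Real.sqrt_le_left (by linarith)]
    linarith
  calc Real.arcosh b ≤ Real.log (2 * b) := by
        rw [Real.arcosh]
        exact Real.log_le_log (by positivity) (by linarith)
    _ = Real.log 2 + Real.log b := Real.log_mul two_ne_zero (by linarith)
    _ ≤ 1 + Real.log b := by linarith [Real.log_two_lt_d9]

lemma sqrt_mul_arcosh_le {b : ℝ} (hb : 1 < b) :
    √(b / (b - 1)) * Real.arcosh b ≤ 3 + 2 * Real.log b := by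
  have hb' : 0 < b - 1 := by linarith
  have hlog : 0 < Real.log b := Real.log_pos hb
  rcases le_total b 2 with hb₂ | hb₂
  · have cancel : b / (b - 1) * (b ^ 2 - 1) = b * (b + 1) := by
      field_simp
      ring
    calc √(b / (b - 1)) * Real.arcosh b ≤ √(b / (b - 1)) * √(b ^ 2 - 1) := by
          gcongr
          exact arcosh_le_sqrt_sq_sub_one hb.le
      _ = √(b * (b + 1)) := by rw [← Real.sqrt_mul (by positivity), cancel]
      _ ≤ 3 := by
          rw [Real.sqrt_le_left (by norm_num)]
          nlinarith
      _ ≤ 3 + 2 * Real.log b := by linarith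
  · have sqrt_le : √(b / (b - 1)) ≤ 2 := by
      rw [Real.sqrt_le_left (by norm_num), div_le_iff₀ hb']
      linarith
    calc √(b / (b - 1)) * Real.arcosh b ≤ 2 * (1 + Real.log b) :=
          mul_le_mul sqrt_le (arcosh_le_one_add_log hb.le) (Real.arcosh_nonneg hb.le) two_pos.le
      _ ≤ 3 + 2 * Real.log b := by linarith

lemma integral_leftMajorant_le {b : ℝ} (hb : 1 < b) :
    ∫ y in 1..b, leftMajorant b y ≤ 7 + 2 * Real.log b := by
  have hb₁ : 0 < √(b - 1) := Real.sqrt_pos.mpr (by linarith)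
  have hb₂ : 0 < √(b + 1) := Real.sqrt_pos.mpr (by linarith)
  have sqrt_part : √(b / (b - 1)) * (4 * √(b - 1) / √(b + 1)) ≤ 4 :=
    calc √(b / (b - 1)) * (4 * √(b - 1) / √(b + 1)) = 4 * (√b / √(b + 1)) := by
          rw [Real.sqrt_div (by linarith)]
          field_simp
      _ ≤ 4 * 1 := by
          gcongr
          exact div_le_one_of_le₀ (Real.sqrt_le_sqrt (by linarith)) hb₂.le
      _ = 4 := mul_one 4
  rw [integral_leftMajorant hb.le, mul_add]
  linarith [sqrt_mul_arcosh_le hb]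

lemma integrableOn_left_singularity {b : ℝ} (hb : 1 ≤ b) :
    IntegrableOn (fun y => √b / (√(b - y) * √(y ^ 2 - 1))) (Set.Ioo 1 b) := by
  have majorant := intervalIntegrable_leftMajorant hb
  rw [intervalIntegrable_iff_integrableOn_Ioo_of_le hb] at majorant
  refine majorant.mono' (Measurable.aestronglyMeasurable (by fun_prop)) ?_
  refine (ae_restrict_mem measurableSet_Ioo).mono fun y hy => ?_
  rw [Real.norm_of_nonneg (by positivity)]
  exact le_leftMajorant hy.1 hy.2

lemma hasDerivAt_arctan_sqrt_sub {c b y : ℝ} (hc : 0 < c) (hy : b < y) :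
    HasDerivAt (fun y => 2 / √c * Real.arctan (√(y - b) / √c))
      (1 / (√(y - b) * (y - b + c))) y := by
  have hyb : 0 < y - b := sub_pos.mpr hy
  have : 0 < √(y - b) := Real.sqrt_pos.mpr hyb
  have : 0 < √c := Real.sqrt_pos.mpr hc
  have one_add_sq : 1 + (√(y - b) / √c) ^ 2 = (y - b + c) / c := by
    rw [div_pow, Real.sq_sqrt hyb.le, Real.sq_sqrt hc.le]
    field_simp
    ring
  refine (((((hasDerivAt_id y).sub_const b).sqrt hyb.ne').div_const
    √c).arctan.const_mul (2 / √c)).congr_deriv ?_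
  simp only [id]
  rw [one_add_sq]
  field_simp
  rw [Real.sq_sqrt hc.le]

lemma integrableOn_one_div_sqrt_mul {c : ℝ} (hc : 0 < c) (b : ℝ) :
    IntegrableOn (fun y => 1 / (√(y - b) * (y - b + c))) (Set.Ioi b) := by
  refine integrableOn_Ioi_deriv_of_nonneg (l := 2 / √c * (π / 2))
    (by fun_prop : Continuous fun y => 2 / √c * Real.arctan (√(y - b) / √c)).continuousWithinAt
    (fun y hy => hasDerivAt_arctan_sqrt_sub hc hy) (fun y hy => ?_) (Tendsto.const_mul _ ?_)
  · have : 0 < y - b := sub_pos.mpr hy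
    positivity
  · have sqrt_tendsto : Tendsto (fun y => √(y - b) / √c) atTop atTop :=
      (Real.tendsto_sqrt_atTop.comp (tendsto_atTop_add_const_right atTop (-b)
        tendsto_id)).atTop_div_const (Real.sqrt_pos.mpr hc)
    exact (tendsto_nhds_of_tendsto_nhdsWithin Real.tendsto_arctan_atTop).comp sqrt_tendsto

lemma integrableOn_right_singularity {b : ℝ} (hb : 1 < b) :
    IntegrableOn (fun y => √b / (√(y - b) * √(y ^ 2 - 1))) (Set.Ioi b) := by
  refine ((integrableOn_one_div_sqrt_mul (sub_pos.mpr hb) b).const_mul √b).mono'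
    (Measurable.aestronglyMeasurable (by fun_prop)) ?_
  refine (ae_restrict_mem measurableSet_Ioi).mono fun y (hy : b < y) => ?_
  have : 0 < √(y - b) := Real.sqrt_pos.mpr (sub_pos.mpr hy)
  have sub_le_sqrt : y - b + (b - 1) ≤ √(y ^ 2 - 1) := Real.le_sqrt_of_sq_le (by nlinarith)
  have : 0 < y - b + (b - 1) := by linarith
  rw [Real.norm_of_nonneg (by positivity), mul_one_div]
  gcongr

lemma integrableOn_Ioi_of_Ioo_of_Ioi {E : Type*} [NormedAddCommGroup E] {a b : ℝ} (hab : a ≤ b)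
    {f : ℝ → E} (hl : IntegrableOn f (Set.Ioo a b)) (hr : IntegrableOn f (Set.Ioi b)) :
    IntegrableOn f (Set.Ioi a) := by
  rw [← Set.Ioc_union_Ioi_eq_Ioi hab]
  exact ((integrableOn_Ioc_iff_integrableOn_Ioo).mpr hl).union hr

lemma sqrt_abs_one_sub_inv_mul {b : ℝ} (hb : 0 < b) (y : ℝ) :
    √|1 - b⁻¹ * y| = √|b - y| / √b := by
  have factor : 1 - b⁻¹ * y = (b - y) / b := by field_simp
  rw [factor, abs_div, abs_of_pos hb, Real.sqrt_div' _ hb.le]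

lemma integrableOn_two_sided_singularity {b : ℝ} (hb : 1 < b) :
    IntegrableOn (fun y => 1 / (√|1 - b⁻¹ * y| * √(y ^ 2 - 1))) (Set.Ioi 1) := by
  have clear_inv (y : ℝ) : 1 / (√|1 - b⁻¹ * y| * √(y ^ 2 - 1)) =
      √b / (√|b - y| * √(y ^ 2 - 1)) := by
    rw [sqrt_abs_one_sub_inv_mul (by linarith), div_mul_eq_mul_div, one_div_div]
  simp only [clear_inv]
  refine integrableOn_Ioi_of_Ioo_of_Ioi hb.le ?_ ?_
  · refine (integrableOn_left_singularity hb.le).congr_fun (fun y hy => ?_) measurableSet_Ioo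
    simp only [abs_of_pos (sub_pos.mpr hy.2)]
  · refine (integrableOn_right_singularity hb).congr_fun (fun y hy => ?_) measurableSet_Ioi
    simp only [abs_sub_comm b y, abs_of_pos (sub_pos.mpr (Set.mem_Ioi.mp hy))]

end SquareRootSingularities

section CoshSubstitution

lemma cosh_image_Ioi : Real.cosh '' Set.Ioi 0 = Set.Ioi 1 := by
  ext y
  constructor
  · rintro ⟨x, hx, rfl⟩
    exact Real.one_lt_cosh.mpr (ne_of_gt hx)
  · intro hy
    exact ⟨Real.arcosh y, Real.arcosh_pos hy, Real.cosh_arcosh (le_of_lt hy)⟩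

lemma sqrt_cosh_sq_sub_one {ξ : ℝ} (hξ : 0 ≤ ξ) : √(Real.cosh ξ ^ 2 - 1) = Real.sinh ξ := by
  rw [← Real.sinh_arcosh (Real.one_le_cosh ξ), Real.arcosh_cosh hξ]

variable {E : Type*} [NormedAddCommGroup E] [NormedSpace ℝ E]

lemma abs_sinh_smul_eqOn (g : ℝ → E) :
    Set.EqOn (fun ξ => |Real.sinh ξ| • g (Real.cosh ξ)) (fun ξ => Real.sinh ξ • g (Real.cosh ξ))
      (Set.Ioi 0) := fun ξ hξ => by
  simp only [abs_of_pos (Real.sinh_pos_iff.mpr (Set.mem_Ioi.mp hξ))]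

lemma integrableOn_Ioi_one_iff_comp_cosh (g : ℝ → E) :
    IntegrableOn g (Set.Ioi 1) ↔
      IntegrableOn (fun ξ => Real.sinh ξ • g (Real.cosh ξ)) (Set.Ioi 0) := by
  rw [← cosh_image_Ioi, integrableOn_image_iff_integrableOn_abs_deriv_smul measurableSet_Ioi
    (fun x _ => (Real.hasDerivAt_cosh x).hasDerivWithinAt)
    (Real.cosh_injOn.mono Set.Ioi_subset_Ici_self)]
  exact integrableOn_congr_fun (abs_sinh_smul_eqOn g) measurableSet_Ioi

lemma integral_Ioi_one_eq_comp_cosh (g : ℝ → E) :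
    ∫ y in Set.Ioi 1, g y = ∫ ξ in Set.Ioi 0, Real.sinh ξ • g (Real.cosh ξ) := by
  rw [← cosh_image_Ioi, integral_image_eq_integral_abs_deriv_smul measurableSet_Ioi
    (fun x _ => (Real.hasDerivAt_cosh x).hasDerivWithinAt)
    (Real.cosh_injOn.mono Set.Ioi_subset_Ici_self)]
  exact setIntegral_congr_fun measurableSet_Ioi (abs_sinh_smul_eqOn g)

lemma integrableOn_one_div_sqrt_abs_one_sub_cosh {b : ℝ} (hb : 1 < b) :
    IntegrableOn (fun ξ => 1 / √|1 - b⁻¹ * Real.cosh ξ|) (Set.Ioi 0) := by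
  refine ((integrableOn_Ioi_one_iff_comp_cosh _).mp
    (integrableOn_two_sided_singularity hb)).congr_fun (fun ξ hξ => ?_) measurableSet_Ioi
  have hs : Real.sinh ξ ≠ 0 := (Real.sinh_pos_iff.mpr hξ).ne'
  simp only [sqrt_cosh_sq_sub_one (le_of_lt hξ), smul_eq_mul]
  rw [mul_one_div, mul_comm (√_), div_mul_eq_div_div, div_self hs]

end CoshSubstitution

section TailWeight

/-- The function `1 / (√(y² - 1) (y + √(y² - 1))ⁿ)` on `y > 1`, that is, `e^{-nξ} / sinh ξ` at
`y = cosh ξ`: up to sign, the value beyond the singularity of the cosine transform of `Jₙ`. -/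
def tailWeight (n : ℕ) (y : ℝ) : ℝ :=
  1 / (√(y ^ 2 - 1) * (y + √(y ^ 2 - 1)) ^ n)

lemma tailWeight_nonneg (n : ℕ) {y : ℝ} (hy : 0 ≤ y) : 0 ≤ tailWeight n y := by
  unfold tailWeight
  positivity

lemma sinh_mul_tailWeight_cosh (n : ℕ) {ξ : ℝ} (hξ : 0 < ξ) :
    Real.sinh ξ * tailWeight n (Real.cosh ξ) = Real.exp (-n * ξ) := by
  have hs : Real.sinh ξ ≠ 0 := (Real.sinh_pos_iff.mpr hξ).ne'
  rw [tailWeight, sqrt_cosh_sq_sub_one hξ.le, Real.cosh_add_sinh, ← Real.exp_nat_mul, neg_mul,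
    Real.exp_neg]
  field_simp

lemma integrableOn_tailWeight {n : ℕ} (hn : n ≠ 0) : IntegrableOn (tailWeight n) (Set.Ioi 1) := by
  rw [integrableOn_Ioi_one_iff_comp_cosh]
  exact (integrableOn_exp_mul_Ioi (by simpa [Nat.pos_iff_ne_zero]) 0).congr_fun
    (fun ξ hξ => (sinh_mul_tailWeight_cosh n hξ).symm) measurableSet_Ioi

lemma integral_tailWeight {n : ℕ} (hn : n ≠ 0) : ∫ y in Set.Ioi 1, tailWeight n y = 1 / n := by
  simp only [integral_Ioi_one_eq_comp_cosh, smul_eq_mul]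
  rw [setIntegral_congr_fun measurableSet_Ioi fun ξ hξ => sinh_mul_tailWeight_cosh n hξ,
    integral_exp_mul_Ioi (by simpa [Nat.pos_iff_ne_zero])]
  simp

lemma integrableOn_tailWeight_inv_mul {n : ℕ} (hn : n ≠ 0) {b : ℝ} (hb : 0 < b) :
    IntegrableOn (fun y => tailWeight n (b⁻¹ * y)) (Set.Ioi b) := by
  rw [integrableOn_Ioi_comp_mul_left_iff _ _ (inv_pos.mpr hb), inv_mul_cancel₀ hb.ne']
  exact integrableOn_tailWeight hn

lemma integral_tailWeight_inv_mul {n : ℕ} (hn : n ≠ 0) {b : ℝ} (hb : 0 < b) :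
    ∫ y in Set.Ioi b, tailWeight n (b⁻¹ * y) = b / n := by
  rw [integral_comp_mul_left_Ioi _ _ (inv_pos.mpr hb), inv_mul_cancel₀ hb.ne',
    integral_tailWeight hn, inv_inv, smul_eq_mul, mul_one_div]

end TailWeight

section Integrands

lemma sqrt_inv_sq {b : ℝ} (hb : 0 ≤ b) : √((b ^ 2)⁻¹) = b⁻¹ := by
  rw [Real.sqrt_inv, Real.sqrt_sq hb]

lemma integrandQ₀_inv_sq {b : ℝ} (hb : 0 ≤ b) (m : ℕ) (t y : ℝ) :
    integrandQ₀ (m + 1) t (b ^ 2)⁻¹ y = Real.cos (2 * t * Real.arcosh y) / √(y ^ 2 - 1) *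
      (Real.cos ((2 * m + 1 : ℕ) * Real.arcsin (b⁻¹ * y)) / √(1 - (b⁻¹ * y) ^ 2)) := by
  have two_mul_sub_one : 2 * ((m + 1 : ℕ) : ℝ) - 1 = (2 * m + 1 : ℕ) := by
    push_cast
    ring
  rw [integrandQ₀, sqrt_inv_sq hb, two_mul_sub_one, mul_pow, inv_pow, mul_comm y b⁻¹, Real.arcosh]
  ring

lemma integrandQ₁_inv_sq {b : ℝ} (hb : 0 ≤ b) (m : ℕ) (t y : ℝ) :
    integrandQ₁ (m + 1) t (b ^ 2)⁻¹ y = Real.cos (2 * t * Real.arcosh y) / √(y ^ 2 - 1) *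
      tailWeight (2 * m + 1) (b⁻¹ * y) := by
  have two_mul_sub_one : 2 * (m + 1) - 1 = 2 * m + 1 := by omega
  rw [integrandQ₁, sqrt_inv_sq hb, two_mul_sub_one, tailWeight, mul_pow, inv_pow, mul_comm y b⁻¹,
    mul_comm (y ^ 2), Real.arcosh, div_mul_div_comm, div_mul_div_comm,
    mul_comm (√((b ^ 2)⁻¹ * y ^ 2 - 1)) (√(y ^ 2 - 1)), mul_assoc (√(y ^ 2 - 1))]

lemma measurable_integrandQ₀ (k : ℕ) (t z : ℝ) : Measurable (integrandQ₀ k t z) := by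
  have := Real.continuous_arcsin.measurable
  unfold integrandQ₀
  fun_prop

lemma measurable_integrandQ₁ (k : ℕ) (t z : ℝ) : Measurable (integrandQ₁ k t z) := by
  unfold integrandQ₁
  fun_prop

lemma one_div_sqrt_one_sub_sq_le {a : ℝ} (ha₀ : 0 ≤ a) (ha : a < 1) :
    1 / √(1 - a ^ 2) ≤ 1 / √(1 - a) := by
  have : 0 < √(1 - a) := Real.sqrt_pos.mpr (by linarith)
  gcongr
  nlinarith

lemma abs_cos_div_mul_le (x : ℝ) {d w : ℝ} (hd : 0 ≤ d) : |Real.cos x / d * w| ≤ 1 / d * |w| := by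
  rw [abs_mul, abs_div, abs_of_nonneg hd]
  gcongr
  exact Real.abs_cos_le_one x

lemma abs_integrandQ₀_le {b : ℝ} (m : ℕ) (t : ℝ) {y : ℝ} (hy : 1 < y) (hyb : y ≤ b) :
    |integrandQ₀ (m + 1) t (b ^ 2)⁻¹ y| ≤ leftMajorant b y := by
  have hb : 0 < b := by linarith
  rw [integrandQ₀_inv_sq hb.le]
  rcases hyb.eq_or_lt with rfl | hyb
  · rw [inv_mul_cancel₀ hb.ne']
    simpa using leftMajorant_nonneg y y
  · have ratio_nonneg : 0 ≤ b⁻¹ * y := by positivity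
    have ratio_lt_one : b⁻¹ * y < 1 := (inv_mul_lt_one₀ hb).mpr hyb
    calc _ ≤ 1 / √(y ^ 2 - 1) * (1 / √(1 - (b⁻¹ * y) ^ 2)) := by
          refine (abs_cos_div_mul_le _ (Real.sqrt_nonneg _)).trans ?_
          rw [abs_div, abs_of_nonneg (Real.sqrt_nonneg _)]
          gcongr
          exact Real.abs_cos_le_one _
      _ ≤ 1 / √(y ^ 2 - 1) * (1 / √(1 - b⁻¹ * y)) := by
          gcongr 1 / √(y ^ 2 - 1) * ?_
          exact one_div_sqrt_one_sub_sq_le ratio_nonneg ratio_lt_one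
      _ = √b / (√(b - y) * √(y ^ 2 - 1)) := by
          rw [← abs_of_pos (sub_pos.mpr ratio_lt_one), sqrt_abs_one_sub_inv_mul hb,
            abs_of_pos (sub_pos.mpr hyb), one_div_div, one_div_mul_eq_div, div_div]
      _ ≤ leftMajorant b y := le_leftMajorant hy hyb

lemma intervalIntegrable_integrandQ₀_inv_sq {b : ℝ} (hb : 1 ≤ b) (m : ℕ) (t : ℝ) :
    IntervalIntegrable (integrandQ₀ (m + 1) t (b ^ 2)⁻¹) volume 1 b := by
  have majorant := intervalIntegrable_leftMajorant hb
  rw [intervalIntegrable_iff_integrableOn_Ioc_of_le hb] at majorant ⊢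
  refine majorant.mono' (measurable_integrandQ₀ _ _ _).aestronglyMeasurable ?_
  exact (ae_restrict_mem measurableSet_Ioc).mono fun y hy => abs_integrandQ₀_le m t hy.1 hy.2

lemma abs_integral_integrandQ₀_le {b : ℝ} (hb : 1 < b) (m : ℕ) (t : ℝ) :
    |∫ y in 1..b, integrandQ₀ (m + 1) t (b ^ 2)⁻¹ y| ≤ 7 + 2 * Real.log b := by
  rw [← Real.norm_eq_abs]
  exact (intervalIntegral.norm_integral_le_of_norm_le hb.le
    (ae_of_all _ fun y hy => abs_integrandQ₀_le m t hy.1 hy.2)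
    (intervalIntegrable_leftMajorant hb.le)).trans (integral_leftMajorant_le hb)

lemma abs_integrandQ₁_le {b : ℝ} (hb : 1 < b) (m : ℕ) (t : ℝ) {y : ℝ} (hy : b < y) :
    |integrandQ₁ (m + 1) t (b ^ 2)⁻¹ y| ≤
      1 / √(b ^ 2 - 1) * tailWeight (2 * m + 1) (b⁻¹ * y) := by
  have hb₀ : 0 < b := by linarith
  have hy₀ : 0 < y := by linarith
  have weight_nonneg := tailWeight_nonneg (2 * m + 1) (by positivity : 0 ≤ b⁻¹ * y)
  have sqrt_pos : 0 < √(b ^ 2 - 1) := Real.sqrt_pos.mpr (by nlinarith)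
  calc _ ≤ 1 / √(y ^ 2 - 1) * |tailWeight (2 * m + 1) (b⁻¹ * y)| := by
        rw [integrandQ₁_inv_sq hb₀.le]
        exact abs_cos_div_mul_le _ (Real.sqrt_nonneg _)
    _ ≤ 1 / √(b ^ 2 - 1) * tailWeight (2 * m + 1) (b⁻¹ * y) := by
        rw [abs_of_nonneg weight_nonneg]
        gcongr

lemma integrableOn_integrandQ₁_inv_sq {b : ℝ} (hb : 1 < b) (m : ℕ) (t : ℝ) :
    IntegrableOn (integrandQ₁ (m + 1) t (b ^ 2)⁻¹) (Set.Ioi b) := by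
  refine ((integrableOn_tailWeight_inv_mul (2 * m).succ_ne_zero (by linarith)).const_mul
    (1 / √(b ^ 2 - 1))).mono' (measurable_integrandQ₁ _ _ _).aestronglyMeasurable ?_
  exact (ae_restrict_mem measurableSet_Ioi).mono fun y hy => abs_integrandQ₁_le hb m t hy

lemma abs_integral_integrandQ₁_le {b : ℝ} (hb : 1 < b) (m : ℕ) (t : ℝ) :
    |∫ y in Set.Ioi b, integrandQ₁ (m + 1) t (b ^ 2)⁻¹ y| ≤
      1 / √(b ^ 2 - 1) * (b / (2 * m + 1 : ℕ)) := by
  have hb₀ : 0 < b := by linarith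
  rw [← integral_tailWeight_inv_mul (2 * m).succ_ne_zero hb₀, ← integral_const_mul,
    ← Real.norm_eq_abs]
  refine norm_integral_le_of_norm_le
    ((integrableOn_tailWeight_inv_mul (2 * m).succ_ne_zero hb₀).const_mul _) ?_
  exact (ae_restrict_mem measurableSet_Ioi).mono fun y hy => abs_integrandQ₁_le hb m t hy

/-- The cosine transform `∫₀^∞ Jₙ(x) cos(a x) dx` of the Bessel function for `a > 0`, `a ≠ 1`. -/
def cosTransformLimit (n : ℕ) (a : ℝ) : ℝ :=
  if a < 1 then Real.cos (n * Real.arcsin a) / √(1 - a ^ 2)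
  else Real.cos ((n + 1) * (π / 2)) * tailWeight n a

lemma tendsto_cosTransform (n : ℕ) {a : ℝ} (ha : 0 < a) (ha₁ : a ≠ 1) :
    Tendsto (cosTransform n · a) atTop (𝓝 (cosTransformLimit n a)) := by
  rw [cosTransformLimit]
  rcases ha₁.lt_or_gt with h | h
  · rw [if_pos h]
    exact tendsto_cosTransform_of_lt_one n ha h
  · rw [if_neg h.not_gt, tailWeight, mul_one_div]
    exact tendsto_cosTransform_of_one_lt n h

lemma integrandQ₀_eq_cosTransformLimit {b : ℝ} (m : ℕ) (t : ℝ) {y : ℝ} (hy : y < b) (hb : 0 < b) :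
    integrandQ₀ (m + 1) t (b ^ 2)⁻¹ y = Real.cos (2 * t * Real.arcosh y) / √(y ^ 2 - 1) *
      cosTransformLimit (2 * m + 1) (b⁻¹ * y) := by
  rw [integrandQ₀_inv_sq hb.le, cosTransformLimit, if_pos ((inv_mul_lt_one₀ hb).mpr hy)]

lemma integrandQ₁_eq_cosTransformLimit {b : ℝ} (m : ℕ) (t : ℝ) {y : ℝ} (hy : b ≤ y) (hb : 0 < b) :
    (-1) ^ (m + 1) * integrandQ₁ (m + 1) t (b ^ 2)⁻¹ y =
      Real.cos (2 * t * Real.arcosh y) / √(y ^ 2 - 1) *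
        cosTransformLimit (2 * m + 1) (b⁻¹ * y) := by
  have angle : ((2 * m + 1 : ℕ) + 1 : ℝ) * (π / 2) = (m + 1 : ℕ) * π := by
    push_cast
    ring
  rw [integrandQ₁_inv_sq hb.le, cosTransformLimit,
    if_neg (mt (inv_mul_lt_one₀ hb).mp hy.not_gt), angle, Real.cos_nat_mul_pi]
  ring

lemma integral_Ioi_one_cosTransformLimit {b : ℝ} (hb : 1 < b) (m : ℕ) (t : ℝ) :
    ∫ y in Set.Ioi 1, Real.cos (2 * t * Real.arcosh y) / √(y ^ 2 - 1) *
        cosTransformLimit (2 * m + 1) (b⁻¹ * y) =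
      (∫ y in 1..b, integrandQ₀ (m + 1) t (b ^ 2)⁻¹ y) +
        (-1) ^ (m + 1) * ∫ y in Set.Ioi b, integrandQ₁ (m + 1) t (b ^ 2)⁻¹ y := by
  have hb₀ : 0 < b := by linarith
  have eq_left : Set.EqOn (integrandQ₀ (m + 1) t (b ^ 2)⁻¹) _ (Set.Ioo 1 b) := fun y hy =>
    integrandQ₀_eq_cosTransformLimit m t hy.2 hb₀
  have eq_right : Set.EqOn (fun y => (-1) ^ (m + 1) * integrandQ₁ (m + 1) t (b ^ 2)⁻¹ y) _
      (Set.Ioi b) := fun y hy => integrandQ₁_eq_cosTransformLimit m t (le_of_lt hy) hb₀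
  have integrable_left := (intervalIntegrable_iff_integrableOn_Ioo_of_le hb.le).mp
    (intervalIntegrable_integrandQ₀_inv_sq hb.le m t)
  have integrable_right : IntegrableOn
      (fun y => (-1) ^ (m + 1) * integrandQ₁ (m + 1) t (b ^ 2)⁻¹ y) (Set.Ioi b) :=
    (integrableOn_integrandQ₁_inv_sq hb m t).const_mul _
  rw [← Set.Ioc_union_Ioi_eq_Ioi hb.le, setIntegral_union (Set.Ioc_disjoint_Ioi le_rfl)
    measurableSet_Ioi
    ((integrableOn_Ioc_iff_integrableOn_Ioo).mpr
      (integrable_left.congr_fun eq_left measurableSet_Ioo))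
    (integrable_right.congr_fun eq_right measurableSet_Ioi), integral_Ioc_eq_integral_Ioo,
    ← setIntegral_congr_fun measurableSet_Ioo eq_left,
    ← setIntegral_congr_fun measurableSet_Ioi eq_right, integral_const_mul,
    intervalIntegral.integral_of_le hb.le, integral_Ioc_eq_integral_Ioo]

lemma integral_cos_mul_cosTransformLimit {b : ℝ} (hb : 1 < b) (m : ℕ) (t : ℝ) :
    ∫ ξ in Set.Ioi 0, Real.cos (2 * t * ξ) *
        cosTransformLimit (2 * m + 1) (b⁻¹ * Real.cosh ξ) =
      (∫ y in 1..b, integrandQ₀ (m + 1) t (b ^ 2)⁻¹ y) +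
        (-1) ^ (m + 1) * ∫ y in Set.Ioi b, integrandQ₁ (m + 1) t (b ^ 2)⁻¹ y := by
  rw [← integral_Ioi_one_cosTransformLimit hb, integral_Ioi_one_eq_comp_cosh]
  refine setIntegral_congr_fun measurableSet_Ioi fun ξ (hξ : 0 < ξ) => ?_
  have hs : Real.sinh ξ ≠ 0 := (Real.sinh_pos_iff.mpr hξ).ne'
  simp only [Real.arcosh_cosh hξ.le, sqrt_cosh_sq_sub_one hξ.le, smul_eq_mul]
  field_simp

end Integrands

section TruncatedKernel

@[fun_prop]
lemma continuous_kPlusTrunc (t T : ℝ) : Continuous (kPlusTrunc t T) := by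
  unfold kPlusTrunc
  refine continuous_const.mul ?_
  refine intervalIntegral.continuous_parametric_intervalIntegral_of_continuous' ?_ _ _
  fun_prop

@[fun_prop]
lemma continuous_cosTransform (n : ℕ) (R : ℝ) : Continuous (cosTransform n R) := by
  unfold cosTransform
  refine intervalIntegral.continuous_parametric_intervalIntegral_of_continuous' ?_ _ _
  fun_prop

lemma abs_kPlusTrunc_le (t x : ℝ) {T : ℝ} (hT : 0 ≤ T) : |kPlusTrunc t T x| ≤ 2 / π * T := by
  have integral_le : |∫ ξ in 0..T, Real.cos (x * Real.cosh ξ) * Real.cos (2 * t * ξ)| ≤ T := by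
    simpa [abs_of_nonneg hT] using intervalIntegral.norm_integral_le_of_norm_le_const (a := 0)
      (b := T) (C := 1) (f := fun ξ => Real.cos (x * Real.cosh ξ) * Real.cos (2 * t * ξ))
      fun ξ _ => by
        rw [norm_mul]
        exact mul_le_one₀ (Real.abs_cos_le_one _) (norm_nonneg _) (Real.abs_cos_le_one _)
  rw [kPlusTrunc, abs_mul, abs_of_pos (by positivity)]
  gcongr

lemma tendsto_div_sinh_atTop (c : ℝ) : Tendsto (fun T => c / Real.sinh T) atTop (𝓝 0) := by
  refine tendsto_const_nhds.div_atTop (tendsto_atTop_mono' atTop ?_ tendsto_id)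
  filter_upwards [eventually_ge_atTop 0] with T hT
  exact Real.self_le_sinh_iff.mpr hT

lemma tendsto_kPlusTrunc (t : ℝ) {x : ℝ} (hx : 0 < x) :
    Tendsto (kPlusTrunc t · x) atTop (𝓝 (kPlusReal t x)) := by
  obtain ⟨C, -, hC⟩ := exists_abs_kPlusReal_sub_kPlusTrunc_le t
  rw [tendsto_iff_norm_sub_tendsto_zero]
  refine squeeze_zero' (Eventually.of_forall fun _ => norm_nonneg _) ?_
    (tendsto_div_sinh_atTop (C / x))
  filter_upwards [eventually_gt_atTop 0] with T hT
  rw [norm_sub_rev, div_div]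
  exact hC x T hx hT

lemma exists_abs_kPlusReal_le (t : ℝ) :
    ∃ C, 0 ≤ C ∧ ∀ x, 0 < x → |kPlusReal t x| ≤ 2 / π + C / x := by
  obtain ⟨C, C_nonneg, hC⟩ := exists_abs_kPlusReal_sub_kPlusTrunc_le t
  have : 0 < Real.sinh 1 := Real.sinh_pos_iff.mpr one_pos
  refine ⟨C / Real.sinh 1, by positivity, fun x hx => ?_⟩
  calc |kPlusReal t x| ≤ |kPlusTrunc t 1 x| + |kPlusReal t x - kPlusTrunc t 1 x| := by
        simpa using abs_add_le (kPlusTrunc t 1 x) (kPlusReal t x - kPlusTrunc t 1 x)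
    _ ≤ 2 / π * 1 + C / (x * Real.sinh 1) :=
        add_le_add (abs_kPlusTrunc_le t x zero_le_one) (hC x 1 hx one_pos)
    _ = 2 / π + C / Real.sinh 1 / x := by rw [mul_one, div_div, mul_comm x]

lemma aestronglyMeasurable_kPlusReal_mul (t : ℝ) {w : ℝ} (hw : 0 < w) (R : ℝ) :
    AEStronglyMeasurable (fun y => kPlusReal t (y * w)) (volume.restrict (Set.Ioc 0 R)) := by
  refine aestronglyMeasurable_of_tendsto_ae (u := atTop)
    (f := fun (T : ℝ) y => kPlusTrunc t T (y * w))
    (fun T => (by fun_prop : Continuous fun y => kPlusTrunc t T (y * w)).aestronglyMeasurable) ?_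
  exact (ae_restrict_mem measurableSet_Ioc).mono fun y hy => tendsto_kPlusTrunc t (mul_pos hy.1 hw)

lemma abs_besselInt_mul_div_le {n : ℕ} (hn : n ≠ 0) {y c d : ℝ} (hy : 0 < y) (hc : 0 ≤ c)
    (hd : 0 < d) : |besselInt n y| * (c / (y * d)) ≤ c / d :=
  calc |besselInt n y| * (c / (y * d)) ≤ y * (c / (y * d)) := by
        gcongr
        exact (abs_besselInt_le hn y).trans_eq (abs_of_pos hy)
    _ = c / d := by field_simp

lemma intervalIntegrable_besselInt_mul_kPlusReal {n : ℕ} (hn : n ≠ 0) {w R : ℝ} (hw : 0 < w)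
    (hR : 0 ≤ R) (t : ℝ) :
    IntervalIntegrable (fun y => besselInt n y * kPlusReal t (y * w)) volume 0 R := by
  obtain ⟨C, C_nonneg, hC⟩ := exists_abs_kPlusReal_le t
  rw [intervalIntegrable_iff_integrableOn_Ioc_of_le hR]
  have integrable_const : IntegrableOn (fun _ : ℝ => 2 / π + C / w) (Set.Ioc 0 R) :=
    integrableOn_const (by simp)
  refine integrable_const.mono' ((continuous_besselInt n).aestronglyMeasurable.mul
    (aestronglyMeasurable_kPlusReal_mul t hw R)) ?_
  refine (ae_restrict_mem measurableSet_Ioc).mono fun y hy => ?_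
  have hyw : 0 < y * w := mul_pos hy.1 hw
  rw [norm_mul, Real.norm_eq_abs, Real.norm_eq_abs]
  calc |besselInt n y| * |kPlusReal t (y * w)|
      ≤ |besselInt n y| * (2 / π + C / (y * w)) := by
        gcongr
        exact hC _ hyw
    _ = |besselInt n y| * (2 / π) + |besselInt n y| * (C / (y * w)) := mul_add _ _ _
    _ ≤ 1 * (2 / π) + C / w := by
        gcongr
        · exact abs_besselInt_le_one n y
        · exact abs_besselInt_mul_div_le hn hy.1 C_nonneg hw
    _ = 2 / π + C / w := by rw [one_mul]

lemma tendsto_integral_besselInt_mul_kPlusTrunc {n : ℕ} (hn : n ≠ 0) {w R : ℝ} (hw : 0 < w)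
    (hR : 0 ≤ R) (t : ℝ) :
    Tendsto (fun T => ∫ y in 0..R, besselInt n y * kPlusTrunc t T (y * w)) atTop
      (𝓝 (∫ y in 0..R, besselInt n y * kPlusReal t (y * w))) := by
  obtain ⟨C, C_nonneg, hC⟩ := exists_abs_kPlusReal_sub_kPlusTrunc_le t
  rw [tendsto_iff_norm_sub_tendsto_zero]
  refine squeeze_zero' (Eventually.of_forall fun _ => norm_nonneg _) ?_
    (tendsto_div_sinh_atTop (C / w * R))
  filter_upwards [eventually_gt_atTop 0] with T hT
  have : 0 < Real.sinh T := Real.sinh_pos_iff.mpr hT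
  rw [← intervalIntegral.integral_sub ((by fun_prop : Continuous fun y =>
    besselInt n y * kPlusTrunc t T (y * w)).intervalIntegrable _ _)
    (intervalIntegrable_besselInt_mul_kPlusReal hn hw hR t)]
  refine (intervalIntegral.norm_integral_le_of_norm_le_const (C := C / (w * Real.sinh T))
    fun y hy => ?_).trans_eq ?_
  · have hy₀ : 0 < y := by
      rw [Set.uIoc_of_le hR] at hy
      exact hy.1
    rw [← mul_sub, norm_mul, norm_sub_rev]
    calc _ ≤ |besselInt n y| * (C / (y * w * Real.sinh T)) := by
          gcongr
          · exact le_rfl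
          · exact hC (y * w) T (by positivity) hT
      _ ≤ C / (w * Real.sinh T) := by
          rw [mul_assoc]
          exact abs_besselInt_mul_div_le hn hy₀ C_nonneg (by positivity)
  · rw [sub_zero, abs_of_nonneg hR]
    field_simp

lemma integrableOn_besselInt_mul_cos_mul_cos (n : ℕ) (w R T t : ℝ) :
    IntegrableOn (Function.uncurry fun y ξ =>
      besselInt n y * (Real.cos (y * w * Real.cosh ξ) * Real.cos (2 * t * ξ)))
      (Set.uIoc 0 R ×ˢ Set.uIoc 0 T) := by
  have continuous_uncurry : Continuous (Function.uncurry fun y ξ : ℝ =>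
      besselInt n y * (Real.cos (y * w * Real.cosh ξ) * Real.cos (2 * t * ξ))) := by
    unfold Function.uncurry
    fun_prop
  exact (continuous_uncurry.continuousOn.integrableOn_compact
    (isCompact_uIcc.prod isCompact_uIcc)).mono_set
    (Set.prod_mono Set.uIoc_subset_uIcc Set.uIoc_subset_uIcc)

lemma integral_besselInt_mul_kPlusTrunc (n : ℕ) (w R t T : ℝ) :
    ∫ y in 0..R, besselInt n y * kPlusTrunc t T (y * w) =
      2 / π * ∫ ξ in 0..T, Real.cos (2 * t * ξ) * cosTransform n R (w * Real.cosh ξ) := by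
  have as_double_integral (y : ℝ) : besselInt n y * kPlusTrunc t T (y * w) = 2 / π *
      ∫ ξ in 0..T, besselInt n y * (Real.cos (y * w * Real.cosh ξ) * Real.cos (2 * t * ξ)) := by
    rw [intervalIntegral.integral_const_mul, kPlusTrunc]
    ring
  have inner_integral (ξ : ℝ) : Real.cos (2 * t * ξ) * cosTransform n R (w * Real.cosh ξ) =
      ∫ y in 0..R, besselInt n y * (Real.cos (y * w * Real.cosh ξ) * Real.cos (2 * t * ξ)) := by
    rw [cosTransform, ← intervalIntegral.integral_const_mul]
    refine intervalIntegral.integral_congr fun y _ => ?_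
    simp only [mul_comm (w * Real.cosh ξ) y, ← mul_assoc]
    ring
  simp only [as_double_integral, inner_integral]
  rw [intervalIntegral.integral_const_mul, intervalIntegral_intervalIntegral_swap
    (integrableOn_besselInt_mul_cos_mul_cos n w R T t)]

end TruncatedKernel

section ImproperIntegral

lemma ae_inv_mul_cosh_ne_one {b : ℝ} (hb : b ≠ 0) :
    ∀ᵐ ξ ∂(volume.restrict (Set.Ioi 0)), b⁻¹ * Real.cosh ξ ≠ 1 := by
  have ae_ne : ∀ᵐ ξ ∂(volume.restrict (Set.Ioi 0)), ξ ≠ Real.arcosh b :=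
    ae_restrict_of_ae (Measure.ae_ne volume _)
  filter_upwards [ae_ne, ae_restrict_mem measurableSet_Ioi] with ξ hξ hξ₀ h
  have cosh_eq : Real.cosh ξ = b := by
    field_simp at h
    exact h
  exact hξ (by rw [← cosh_eq, Real.arcosh_cosh (le_of_lt hξ₀)])

lemma exists_abs_cos_mul_cosTransform_le (n : ℕ) {b : ℝ} (hb : 0 < b) (t : ℝ) :
    ∃ C, ∀ R, 0 ≤ R → ∀ᵐ ξ ∂(volume.restrict (Set.Ioi 0)),
      |Real.cos (2 * t * ξ) * cosTransform n R (b⁻¹ * Real.cosh ξ)| ≤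
        C * (1 / √|1 - b⁻¹ * Real.cosh ξ|) := by
  obtain ⟨C, -, hC⟩ := exists_abs_cosTransform_le n
  refine ⟨C, fun R hR => ?_⟩
  filter_upwards [ae_inv_mul_cosh_ne_one hb.ne'] with ξ hξ
  rw [abs_mul, mul_one_div]
  exact (mul_le_of_le_one_left (abs_nonneg _) (Real.abs_cos_le_one _)).trans
    (hC R _ hR (by positivity) hξ)

lemma integrableOn_cos_mul_cosTransform {b : ℝ} (hb : 1 < b) (n : ℕ) {R : ℝ} (hR : 0 ≤ R)
    (t : ℝ) : IntegrableOn
      (fun ξ => Real.cos (2 * t * ξ) * cosTransform n R (b⁻¹ * Real.cosh ξ)) (Set.Ioi 0) := by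
  obtain ⟨C, hC⟩ := exists_abs_cos_mul_cosTransform_le n (by linarith : 0 < b) t
  exact ((integrableOn_one_div_sqrt_abs_one_sub_cosh hb).const_mul C).mono'
    (by fun_prop : Continuous _).aestronglyMeasurable (hC R hR)

lemma integral_besselInt_mul_kPlusReal {b : ℝ} (hb : 1 < b) {n : ℕ} (hn : n ≠ 0) {R : ℝ}
    (hR : 0 ≤ R) (t : ℝ) :
    ∫ y in 0..R, besselInt n y * kPlusReal t (y * b⁻¹) =
      2 / π * ∫ ξ in Set.Ioi 0, Real.cos (2 * t * ξ) * cosTransform n R (b⁻¹ * Real.cosh ξ) := by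
  refine tendsto_nhds_unique
    (tendsto_integral_besselInt_mul_kPlusTrunc hn (inv_pos.mpr (by linarith)) hR t) ?_
  simp only [integral_besselInt_mul_kPlusTrunc]
  exact (intervalIntegral_tendsto_integral_Ioi 0
    (integrableOn_cos_mul_cosTransform hb n hR t) tendsto_id).const_mul (2 / π)

lemma tendsto_integral_cos_mul_cosTransform {b : ℝ} (hb : 1 < b) (n : ℕ) (t : ℝ) :
    Tendsto (fun R => ∫ ξ in Set.Ioi 0,
        Real.cos (2 * t * ξ) * cosTransform n R (b⁻¹ * Real.cosh ξ)) atTop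
      (𝓝 (∫ ξ in Set.Ioi 0, Real.cos (2 * t * ξ) * cosTransformLimit n (b⁻¹ * Real.cosh ξ))) := by
  have hb₀ : 0 < b := by linarith
  obtain ⟨C, hC⟩ := exists_abs_cos_mul_cosTransform_le n hb₀ t
  refine tendsto_integral_filter_of_dominated_convergence
    (fun ξ => C * (1 / √|1 - b⁻¹ * Real.cosh ξ|))
    (Eventually.of_forall fun R => (by fun_prop : Continuous _).aestronglyMeasurable)
    ((eventually_ge_atTop 0).mono hC)
    ((integrableOn_one_div_sqrt_abs_one_sub_cosh hb).const_mul C) ?_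
  filter_upwards [ae_inv_mul_cosh_ne_one hb₀.ne'] with ξ hξ
  exact (tendsto_cosTransform n (by positivity) hξ).const_mul _

lemma integrandI_inv_sq {b : ℝ} (hb : 0 < b) (m : ℕ) (t : ℝ) {y : ℝ} (hy : 0 < y) :
    integrandI (m + 1) t (b ^ 2)⁻¹ y =
      ((besselInt (2 * m + 1) y * kPlusReal t (y * b⁻¹) : ℝ) : ℂ) := by
  have two_mul_sub_one : 2 * ((m + 1 : ℕ) : ℂ) - 1 = (2 * m + 1 : ℕ) := by
    push_cast
    ring
  rw [integrandI, sqrt_inv_sq hb.le, kPlus_eq_kPlusReal (by positivity), two_mul_sub_one,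
    besselJ_natCast hy, Complex.ofReal_mul]

lemma hasImproperIntegral_integrandI_inv_sq {b : ℝ} (hb : 1 < b) (m : ℕ) (t : ℝ) :
    HasImproperIntegral (integrandI (m + 1) t (b ^ 2)⁻¹)
      ((2 / π * ((∫ y in 1..b, integrandQ₀ (m + 1) t (b ^ 2)⁻¹ y) +
        (-1) ^ (m + 1) * ∫ y in Set.Ioi b, integrandQ₁ (m + 1) t (b ^ 2)⁻¹ y) : ℝ) : ℂ) := by
  have hb₀ : 0 < b := by linarith
  have integrand_eq (R : ℝ) (hR : 0 < R) : Set.EqOn (integrandI (m + 1) t (b ^ 2)⁻¹)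
      (fun y => ((besselInt (2 * m + 1) y * kPlusReal t (y * b⁻¹) : ℝ) : ℂ)) (Set.uIoc 0 R) := by
    intro y hy
    rw [Set.uIoc_of_le hR.le] at hy
    exact integrandI_inv_sq hb₀ m t hy.1
  refine ⟨fun R hR => IntervalIntegrable.congr (integrand_eq R hR).symm ?_, ?_⟩
  · have h := intervalIntegrable_besselInt_mul_kPlusReal (2 * m).succ_ne_zero (inv_pos.mpr hb₀)
      hR.le t
    exact ⟨h.1.ofReal, h.2.ofReal⟩
  · rw [← integral_cos_mul_cosTransformLimit hb]
    refine ((Complex.continuous_ofReal.tendsto _).comp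
      ((tendsto_integral_cos_mul_cosTransform hb (2 * m + 1) t).const_mul (2 / π))).congr' ?_
    filter_upwards [eventually_gt_atTop 0] with R hR
    rw [Function.comp_apply, ← integral_besselInt_mul_kPlusReal hb (2 * m).succ_ne_zero hR.le,
      ← intervalIntegral.integral_ofReal]
    exact intervalIntegral.integral_congr_ae (ae_of_all _ fun y hy => (integrand_eq R hR hy).symm)

lemma HasImproperIntegral.integralI_eq {k : ℕ} {t z : ℝ} {L : ℂ}
    (h : HasImproperIntegral (integrandI k t z) L) : integralI k t z = L :=
  h.2.limUnder_eq

lemma exists_eq_inv_sq {z : ℝ} (hz : 0 < z) (hz₁ : z < 1) : ∃ b : ℝ, 1 < b ∧ z = (b ^ 2)⁻¹ := by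
  refine ⟨(√z)⁻¹, (one_lt_inv₀ (Real.sqrt_pos.mpr hz)).mpr ?_, ?_⟩
  · rwa [Real.sqrt_lt' one_pos, one_pow]
  · rw [inv_pow, inv_inv, Real.sq_sqrt hz.le]

lemma one_div_sqrt_inv_sq {b : ℝ} (hb : 0 ≤ b) : 1 / √((b ^ 2)⁻¹) = b := by
  rw [sqrt_inv_sq hb, one_div, inv_inv]

variable {k : ℕ} {z : ℝ}

lemma hasImproperIntegral_integrandI (hk : 1 ≤ k) (t : ℝ) (hz : 0 < z) (hz₁ : z < 1) :
    HasImproperIntegral (integrandI k t z)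
      ((2 / π * (Q₀ k t z + (-1) ^ k * Q₁ k t z) : ℝ) : ℂ) := by
  obtain ⟨b, hb, rfl⟩ := exists_eq_inv_sq hz hz₁
  obtain ⟨m, rfl⟩ := Nat.exists_eq_add_of_le' hk
  rw [Q₀, Q₁, one_div_sqrt_inv_sq (by linarith)]
  exact hasImproperIntegral_integrandI_inv_sq hb m t

lemma intervalIntegrable_integrandQ₀ (hk : 1 ≤ k) (t : ℝ) (hz : 0 < z) (hz₁ : z < 1) :
    IntervalIntegrable (integrandQ₀ k t z) volume 1 (1 / √z) := by
  obtain ⟨b, hb, rfl⟩ := exists_eq_inv_sq hz hz₁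
  obtain ⟨m, rfl⟩ := Nat.exists_eq_add_of_le' hk
  rw [one_div_sqrt_inv_sq (by linarith)]
  exact intervalIntegrable_integrandQ₀_inv_sq hb.le m t

lemma integrableOn_integrandQ₁ (hk : 1 ≤ k) (t : ℝ) (hz : 0 < z) (hz₁ : z < 1) :
    IntegrableOn (integrandQ₁ k t z) (Set.Ioi (1 / √z)) := by
  obtain ⟨b, hb, rfl⟩ := exists_eq_inv_sq hz hz₁
  obtain ⟨m, rfl⟩ := Nat.exists_eq_add_of_le' hk
  rw [one_div_sqrt_inv_sq (by linarith)]
  exact integrableOn_integrandQ₁_inv_sq hb m t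

lemma abs_Q₀_le (hk : 1 ≤ k) (t : ℝ) (hz : 0 < z) (hz₁ : z < 1) :
    |Q₀ k t z| ≤ 7 + |Real.log z| := by
  obtain ⟨b, hb, rfl⟩ := exists_eq_inv_sq hz hz₁
  obtain ⟨m, rfl⟩ := Nat.exists_eq_add_of_le' hk
  have abs_log : |Real.log (b ^ 2)⁻¹| = 2 * Real.log b := by
    rw [Real.log_inv, abs_neg, Real.log_pow, Nat.cast_ofNat, abs_of_pos]
    exact mul_pos two_pos (Real.log_pos hb)
  rw [Q₀, one_div_sqrt_inv_sq (by linarith), abs_log]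
  exact abs_integral_integrandQ₀_le hb m t

lemma abs_Q₁_le (hk : 1 ≤ k) (t : ℝ) (hz : 0 < z) (hz₁ : z < 1) :
    |Q₁ k t z| ≤ 1 / ((2 * (k : ℝ) - 1) * √(1 - z)) := by
  obtain ⟨b, hb, rfl⟩ := exists_eq_inv_sq hz hz₁
  obtain ⟨m, rfl⟩ := Nat.exists_eq_add_of_le' hk
  have hb₀ : 0 < b := by linarith
  have sqrt_eq : √(1 - (b ^ 2)⁻¹) = √(b ^ 2 - 1) / b := by
    have factor : 1 - (b ^ 2)⁻¹ = (b ^ 2 - 1) / b ^ 2 := by field_simp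
    rw [factor, Real.sqrt_div' _ (by positivity), Real.sqrt_sq hb₀.le]
  have two_mul_sub_one : 2 * ((m + 1 : ℕ) : ℝ) - 1 = (2 * m + 1 : ℕ) := by
    push_cast
    ring
  rw [Q₁, one_div_sqrt_inv_sq hb₀.le, sqrt_eq, two_mul_sub_one]
  refine (abs_integral_integrandQ₁_le hb m t).trans_eq ?_
  field_simp

lemma norm_two_div_pi_mul_le (hk : 1 ≤ k) (t : ℝ) (hz : 0 < z) (hz₁ : z < 1) :
    ‖((2 / π * (Q₀ k t z + (-1) ^ k * Q₁ k t z) : ℝ) : ℂ)‖ ≤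
      7 * (1 + |Real.log z| + 1 / ((2 * (k : ℝ) - 1) * √(1 - z))) := by
  have two_div_pi_le_one : 2 / π ≤ 1 := by
    rw [div_le_one Real.pi_pos]
    exact Real.two_le_pi
  have abs_sign_mul : |(-1) ^ k * Q₁ k t z| = |Q₁ k t z| := by
    rw [abs_mul, abs_neg_one_pow, one_mul]
  have Q₁_bound := abs_Q₁_le hk t hz hz₁
  rw [Complex.norm_real, Real.norm_eq_abs, abs_mul, abs_of_pos (by positivity)]
  calc 2 / π * |Q₀ k t z + (-1) ^ k * Q₁ k t z| ≤ 1 * (|Q₀ k t z| + |(-1) ^ k * Q₁ k t z|) := by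
        gcongr
        exact abs_add_le _ _
    _ ≤ (7 + |Real.log z|) + 1 / ((2 * (k : ℝ) - 1) * √(1 - z)) := by
        rw [one_mul, abs_sign_mul]
        exact add_le_add (abs_Q₀_le hk t hz hz₁) Q₁_bound
    _ ≤ _ := by linarith [abs_nonneg (Real.log z), (abs_nonneg _).trans Q₁_bound]

end ImproperIntegral

end BesselDecomp

end

theorem mainTheorem4 :
    (∀ (k : ℕ) (t z : ℝ), 1 ≤ k → 0 < z → z < 1 →
      BesselDecomp.HasImproperIntegral (BesselDecomp.integrandI k t z)
          (BesselDecomp.integralI k t z) ∧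
        IntervalIntegrable (BesselDecomp.integrandQ₀ k t z) MeasureTheory.volume 1 (1 / √z) ∧
        MeasureTheory.IntegrableOn (BesselDecomp.integrandQ₁ k t z) (Set.Ioi (1 / √z)) ∧
        BesselDecomp.integralI k t z =
          2 / (Real.pi : ℂ) *
            ((BesselDecomp.Q₀ k t z : ℂ) + (-1) ^ k * (BesselDecomp.Q₁ k t z : ℂ))) ∧
    (∃ C : ℝ, 0 < C ∧ ∀ (k : ℕ) (t z : ℝ), 1 ≤ k → 0 < z → z < 1 →
      ‖BesselDecomp.integralI k t z‖ ≤
        C * (1 + |Real.log z| + 1 / ((2 * (k : ℝ) - 1) * √(1 - z)))) := by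
  open BesselDecomp in
  refine ⟨fun k t z hk hz hz₁ => ?_, 7, by norm_num, fun k t z hk hz hz₁ => ?_⟩
  · have converges := hasImproperIntegral_integrandI hk t hz hz₁
    rw [converges.integralI_eq]
    exact ⟨converges, intervalIntegrable_integrandQ₀ hk t hz hz₁,
      integrableOn_integrandQ₁ hk t hz hz₁, by push_cast; rfl⟩
  · rw [(hasImproperIntegral_integrandI hk t hz hz₁).integralI_eq]
    exact norm_two_div_pi_mul_le hk t hz hz₁
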